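/- **Theorem (DispersedLedger is well-defined).** Let $N \ge 3f+1$. Consider $N$ nodes, at most $f$ of which are Byzantine (arbitrary behaviour); let $H$ be the set of correct nodes. The network is asynchronous and authenticated: messages between correct nodes can be delayed arbitrarily but are eventually received, and correct nodes eventually take every step that stays possible. The hash functions are secure in the sense that no hash collision occurs among the inputs hashed in the run. *Binary agreement (BA).* Each instance has the properties: if all correct nodes invoke $\mathtt{Input}$, every correct node eventually gets an $\mathtt{Output}$; if a correct node gets $\mathtt{Output}(b)$, every correct node eventually gets $\mathtt{Output}(b)$; if a correct node gets $\mathtt{Output}(b)$, some correct node has invoked $\mathtt{Input}(b)$. *Dispersal (AVID-M).* To disperse $B$, a client encodes $B$ with an $(N-2f,N)$-erasure code into chunks $C_1,\dots,C_N$, with Merkle root $r$, and sends $\mathtt{Chunk}(r,C_i,P_i)$ to each server $i$, where $P_i$ is the Merkle proof of $C_i$. A server that gets its first valid $\mathtt{Chunk}(r,\cdot,\cdot)$ from the node for which the instance is reserved stores it and broadcasts $\mathtt{GotChunk}(r)$; on $N-f$ $\mathtt{GotChunk}(r)$ or on $f+1$ $\mathtt{Ready}(r)$ it broadcasts $\mathtt{Ready}(r)$;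 on $2f+1$ $\mathtt{Ready}(r)$ it sets $\mathtt{ChunkRoot}=r$ and the dispersal is $\mathtt{Complete}$ at it. To $\mathtt{Retrieve}$, a client sends a request to all servers; a server answers with its root, chunk and proof as soon as the dispersal is complete at it and its root equals $\mathtt{ChunkRoot}$. When the client has $N-2f$ valid chunks with the same root $r$, it decodes them to $B'$ and returns $B'$ if the Merkle root of the encoding of $B'$ is $r$, and BAD_UPLOADER otherwise. Duplicate messages (same sender and type) are ignored. *Epoch $e=1,2,\dots$ at node $i$.* There are instances $\mathrm{VID}^e_j$ of AVID-M and $\mathrm{BA}^e_j$ of BA for $1\le j\le N$. Dispersal phase: node $i$ disperses, on $\mathrm{VID}^e_i$, a block made of transactions and the array $V^e_i$, where $V^e_i[j]$ is the largest $t$ such that $\mathrm{VID}^1_j,\dots,\mathrm{VID}^t_j$ have completed at node $i$. When $\mathrm{VID}^e_j$ completes, it invokes $\mathtt{Input}(1)$ on $\mathrm{BA}^e_j$ unless it has already invoked $\mathtt{Input}$ there; when $N-f$ BA instances of the epoch have $\mathtt{Output}(1)$, it invokes $\mathtt{Input}(0)$ on all those without input. When all $N$ BA instances have output, $S^e_i$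 is the set of $j$ such that $\mathrm{BA}^e_j$ has $\mathtt{Output}(1)$, and node $i$ starts the dispersal phase of epoch $e+1$ and, concurrently, the retrieval phase of epoch $e$. Retrieval phase (blocks are delivered epoch by epoch): it retrieves $\mathrm{VID}^e_j$ for all $j\in S^e_i$ and delivers these blocks; it lets $E^e_i[j]$ be the $(f+1)$-th largest value for $j$ among the arrays in these blocks (an ill-formatted block or BAD_UPLOADER counts as $[\infty,\dots,\infty]$); it retrieves $\mathrm{VID}^d_j$ for all $j$ and $1\le d\le E^e_i[j]$ not yet delivered; and it delivers these blocks, sorted by epoch and node. Then node $i$ has *finished* epoch $e$. In every such run, for every epoch $e\ge1$ and every $i\in H$: 1. at least $N-f$ of the instances $\mathrm{BA}^e_1,\dots,\mathrm{BA}^e_N$ eventually $\mathtt{Output}(1)$ at node $i$; 2. all of $\mathrm{BA}^e_1,\dots,\mathrm{BA}^e_N$ eventually $\mathtt{Output}$ at node $i$; 3. for every $j\in S^e_i$, the retrieval of $\mathrm{VID}^e_j$ by node $i$ eventually completes, and for every $j$ and $1\le d\le E^e_i[j]$, the retrieval of $\mathrm{VID}^d_j$ by node $i$ eventually completes; 4.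 node $i$ eventually finishes epoch $e$. -/

import Mathlib

/-!
The DispersedLedger protocol with inter-node linking, run by `N` nodes of which at most `f` are
Byzantine, over an asynchronous authenticated network.  Blocks are dispersed and retrieved with
AVID-M (erasure code, Merkle tree, `GotChunk` / `Ready` voting), which is spelled out message by
message.  Binary agreement is used through its defining properties.
-/

namespace DispersedLedger

noncomputable section

open scoped Classical

/-! ### Erasure codes, Merkle trees, block format -/

/-- A `(k, n)`-erasure code: a block is encoded into `n` chunks, any `k` of which decode to it.
`decode` is applied to a partial array of chunks; nothing is known about its value on chunks that
do not come from a common encoding. -/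
structure ErasureCode (k n : ℕ) (Data Chunk : Type*) where
  encode : Data → Fin n → Chunk
  decode : (Fin n → Option Chunk) → Data
  decode_encode : ∀ (B : Data) (D : Finset (Fin n)), D.card = k →
    decode (fun i => if i ∈ D then some (encode B i) else none) = B

/-- A serialization of blocks: a list of transactions together with an observation array.
`parse` returns `none` on ill-formatted data. -/
structure BlockFormat (N : ℕ) (Tx Data : Type*) where
  serialize : List Tx → (Fin N → ℕ∞) → Data
  parse : Data → Option (List Tx × (Fin N → ℕ∞))
  parse_serialize : ∀ T V, parse (serialize T V) = some (T, V)

/-- The hash functions used at the leaves and at the inner nodes of a Merkle tree, and the digest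
which pads the leaves up to a power of two. No property is required of them here. -/
structure MerkleHash (Chunk Digest : Type*) where
  leaf : Chunk → Digest
  node : Digest → Digest → Digest
  pad : Digest

section Merkle

variable {Digest : Type*} (node : Digest → Digest → Digest)

/-- Root of the perfect binary tree of depth `d` with leaves `a 0, …, a (2 ^ d - 1)`. -/
def treeRoot : ℕ → (ℕ → Digest) → Digest
  | 0, a => a 0
  | d + 1, a => node (treeRoot d a) (treeRoot d fun i => a (i + 2 ^ d))

/-- The siblings on the path from the root to leaf `i`, topmost sibling first. -/
def treeProof : ℕ → (ℕ → Digest) → ℕ → List Digest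
  | 0, _, _ => []
  | d + 1, a, i =>
      if i < 2 ^ d then
        treeRoot node d (fun k => a (k + 2 ^ d)) :: treeProof d a i
      else
        treeRoot node d a :: treeProof d (fun k => a (k + 2 ^ d)) (i - 2 ^ d)

/-- The root computed from leaf digest `y` at position `i` and a list of siblings; `none` if the
number of siblings is not the depth. -/
def pathRoot : ℕ → ℕ → Digest → List Digest → Option Digest
  | 0, _, y, [] => some y
  | 0, _, _, _ :: _ => none
  | _ + 1, _, _, [] => none
  | d + 1, i, y, s :: p =>
      if i < 2 ^ d then (pathRoot d i y p).map (fun z => node z s)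
      else (pathRoot d (i - 2 ^ d) y p).map (fun z => node s z)

/-- The arguments on which `node` is evaluated when `treeRoot` is computed. -/
def treeQueries : ℕ → (ℕ → Digest) → Set (Digest × Digest)
  | 0, _ => ∅
  | d + 1, a =>
      {(treeRoot node d a, treeRoot node d fun i => a (i + 2 ^ d))} ∪
        (treeQueries d a ∪ treeQueries d fun i => a (i + 2 ^ d))

/-- The arguments on which `node` is evaluated when `pathRoot` is computed. -/
def pathQueries : ℕ → ℕ → Digest → List Digest → Set (Digest × Digest)
  | d + 1, i, y, s :: p =>
      if i < 2 ^ d then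
        {q | pathRoot node d i y p = some q.1 ∧ q.2 = s} ∪ pathQueries d i y p
      else
        {q | q.1 = s ∧ pathRoot node d (i - 2 ^ d) y p = some q.2} ∪ pathQueries d (i - 2 ^ d) y p
  | _, _, _, _ => ∅

end Merkle

/-- The public parameters of the protocol besides `N` and `f`. -/
structure Params (N f : ℕ) (Tx Data Chunk Digest : Type*) where
  code : ErasureCode (N - 2 * f) N Data Chunk
  format : BlockFormat N Tx Data
  hash : MerkleHash Chunk Digest

variable {N f : ℕ} {Tx Data Chunk Digest : Type*}

namespace Params

variable (P : Params N f Tx Data Chunk Digest)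

/-- Depth of the Merkle tree over `N` chunks. -/
def depth (_ : Params N f Tx Data Chunk Digest) : ℕ := Nat.clog 2 N

/-- The leaf digests of the Merkle tree over the chunks `C`. -/
def leaves (C : Fin N → Chunk) (i : ℕ) : Digest :=
  if h : i < N then P.hash.leaf (C ⟨i, h⟩) else P.hash.pad

/-- Merkle root of an array of chunks. -/
def merkleRoot (C : Fin N → Chunk) : Digest := treeRoot P.hash.node P.depth (P.leaves C)

/-- Merkle proof that `C i` is the `i`-th chunk under `merkleRoot C`. -/
def merkleProof (C : Fin N → Chunk) (i : Fin N) : List Digest :=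
  treeProof P.hash.node P.depth (P.leaves C) i

/-- Check of the proof `p` that `c` is the `i`-th chunk under root `r`. -/
def Verify (r : Digest) (i : Fin N) (c : Chunk) (p : List Digest) : Prop :=
  pathRoot P.hash.node P.depth i (P.hash.leaf c) p = some r

end Params

/-! ### AVID-M -/

/-- `(e, j)` names the VID instance and the BA instance of epoch `e` and node `j`.
Epochs are numbered from `1`. -/
abbrev Inst (N : ℕ) := ℕ × Fin N

/-- Messages of an instance of AVID-M. -/
inductive Msg (Chunk Digest : Type*)
  | chunk (r : Digest) (c : Chunk) (p : List Digest)
  | gotChunk (r : Digest)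
  | ready (r : Digest)
  | requestChunk
  | returnChunk (r : Digest) (c : Chunk) (p : List Digest)

/-- State of a server in one VID instance. -/
structure ServerState (N : ℕ) (Chunk Digest : Type*) where
  /-- `MyRoot`, `MyChunk`, `MyProof` -/
  mine : Option (Digest × Chunk × List Digest)
  /-- root in the first `GotChunk` message received from each server -/
  gotFrom : Fin N → Option Digest
  /-- root in the first `Ready` message received from each server -/
  readyFrom : Fin N → Option Digest
  /-- `ChunkRoot`; the dispersal is `Complete` when it is set -/
  chunkRoot : Option Digest
  /-- the clients from which `RequestChunk` was received -/
  requests : Finset (Fin N)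

/-- `ShareCount[r]` -/
def ServerState.shareCount (s : ServerState N Chunk Digest) (r : Digest) : ℕ :=
  (Finset.univ.filter fun j => s.gotFrom j = some r).card

/-- `ReadyCount[r]` -/
def ServerState.readyCount (s : ServerState N Chunk Digest) (r : Digest) : ℕ :=
  (Finset.univ.filter fun j => s.readyFrom j = some r).card

/-- Broadcast of `m` (to all servers, including the sender). -/
def toAll (m : Msg Chunk Digest) : Set (Fin N × Msg Chunk Digest) := {q | q.2 = m}

/-- The answers to the chunk requests received so far, which are deferred until the dispersal is
`Complete`, the chunk is set, and `MyRoot = ChunkRoot`. -/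
def ServerState.answers (s : ServerState N Chunk Digest) : Set (Fin N × Msg Chunk Digest) :=
  {q | q.1 ∈ s.requests ∧ ∃ r c p,
    s.mine = some (r, c, p) ∧ s.chunkRoot = some r ∧ q.2 = .returnChunk r c p}

/-- Message handler of server `me` in the VID instance `x`: new state and messages sent.
Duplicates (same sender and same type) are ignored, as are `Chunk` messages that do not come from
the node for which the instance is reserved. -/
def serverHandler (P : Params N f Tx Data Chunk Digest) (me : Fin N) (x : Inst N) (src : Fin N)
    (s : ServerState N Chunk Digest) :
    Msg Chunk Digest → ServerState N Chunk Digest × Set (Fin N × Msg Chunk Digest)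
  | .chunk r c p =>
      if src = x.2 ∧ P.Verify r me c p ∧ s.mine = none then
        ({ s with mine := some (r, c, p) }, toAll (.gotChunk r))
      else (s, ∅)
  | .gotChunk r =>
      if s.gotFrom src = none then
        let s' := { s with gotFrom := Function.update s.gotFrom src (some r) }
        (s', if N - f ≤ s'.shareCount r then toAll (.ready r) else ∅)
      else (s, ∅)
  | .ready r =>
      if s.readyFrom src = none then
        let s' := { s with readyFrom := Function.update s.readyFrom src (some r) }
        ({ s' with chunkRoot := if 2 * f + 1 ≤ s'.readyCount r then some r else s'.chunkRoot },
          if f + 1 ≤ s'.readyCount r then toAll (.ready r) else ∅)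
      else (s, ∅)
  | .requestChunk => ({ s with requests := insert src s.requests }, ∅)
  | .returnChunk _ _ _ => (s, ∅)

/-- What a `Retrieve` returns. -/
inductive Retrieved (Data : Type*)
  | block (B : Data)
  | badUploader

/-- State of a client in one VID instance. -/
structure ClientState (N : ℕ) (Data Chunk Digest : Type*) where
  /-- `Retrieve` has been invoked -/
  invoked : Prop
  /-- root and chunk in the first valid `ReturnChunk` message received from each server -/
  chunks : Fin N → Option (Digest × Chunk)
  /-- the returned value, once `Retrieve` has finished -/
  result : Option (Retrieved Data)

/-- The chunks stored with root `r`. -/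
def ClientState.under (s : ClientState N Data Chunk Digest) (r : Digest) (j : Fin N) :
    Option Chunk :=
  match s.chunks j with
  | some (r', c) => if r' = r then some c else none
  | none => none

/-- Decode, re-encode and compare the Merkle roots. -/
def decodeAndCheck (P : Params N f Tx Data Chunk Digest) (r : Digest)
    (C : Fin N → Option Chunk) : Retrieved Data :=
  if P.merkleRoot (P.code.encode (P.code.decode C)) = r then .block (P.code.decode C)
  else .badUploader

/-- Message handler of a client. The `Retrieve` finishes at the moment when `N - 2f` chunks with
the same root have been stored, so exactly `N - 2f` chunks are decoded. -/
def clientHandler (P : Params N f Tx Data Chunk Digest) (src : Fin N)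
    (s : ClientState N Data Chunk Digest) :
    Msg Chunk Digest → ClientState N Data Chunk Digest
  | .returnChunk r c p =>
      if s.invoked ∧ s.result = none ∧ P.Verify r src c p ∧ s.chunks src = none then
        let s' := { s with chunks := Function.update s.chunks src (some (r, c)) }
        if N - 2 * f ≤ (Finset.univ.filter fun j => s'.under r j ≠ none).card then
          { s' with result := some (decodeAndCheck P r (s'.under r)) }
        else s'
      else s
  | _ => s

/-! ### The state of a node -/

/-- Local state of a node. -/
structure NodeState (N : ℕ) (Tx Data Chunk Digest : Type*) where
  server : Inst N → ServerState N Chunk Digest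
  client : Inst N → ClientState N Data Chunk Digest
  /-- value on which `Input` was invoked on each BA instance -/
  baIn : Inst N → Option Bool
  /-- value of the `Output` event of each BA instance -/
  baOut : Inst N → Option Bool
  /-- the epoch whose dispersal phase the node is in; all earlier epochs are past this phase -/
  epoch : ℕ
  /-- the block on which `Disperse` was invoked in each epoch -/
  proposed : ℕ → Option Data
  /-- number of finished epochs: epochs `1, …, finished` have gone through both phases -/
  finished : ℕ
  /-- in the retrieval phase of epoch `finished + 1`: `none` before step 4 is reached, and then the
  set of instances to be retrieved by inter-node linking -/
  linking : Option (Set (Inst N))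
  /-- the instances with `Delivered[e][j] = 1` -/
  delivered : Set (Inst N)
  /-- the sequence of delivered blocks; `none` stands for an ill-formatted block -/
  log : List (Inst N × Option (List Tx))

namespace NodeState

/-- Initially nothing has happened and the node is about to start epoch `1`. -/
def initial : NodeState N Tx Data Chunk Digest where
  server _ := ⟨none, fun _ => none, fun _ => none, none, ∅⟩
  client _ := ⟨False, fun _ => none, none⟩
  baIn _ := none
  baOut _ := none
  epoch := 1
  proposed _ := none
  finished := 0
  linking := none
  delivered := ∅
  log := []

/-- The dispersal of VID instance `x` is `Complete` at this node. -/
def Completed (s : NodeState N Tx Data Chunk Digest) (x : Inst N) : Prop :=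
  (s.server x).chunkRoot ≠ none

/-- The `Retrieve` of VID instance `x` has finished at this node. -/
def HasRetrieved (s : NodeState N Tx Data Chunk Digest) (x : Inst N) : Prop :=
  (s.client x).result ≠ none

/-- `V[j]`: the largest `t` such that the VID instances of node `j` for the epochs `1, …, t` have
completed at this node. -/
def observation (s : NodeState N Tx Data Chunk Digest) (j : Fin N) : ℕ∞ :=
  ⨆ (t : ℕ) (_ : ∀ d, 1 ≤ d → d ≤ t → s.Completed (d, j)), (t : ℕ∞)

/-- `S^e`: the indices of the BA instances of epoch `e` that have `Output(1)` at this node. -/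
def selected (s : NodeState N Tx Data Chunk Digest) (e : ℕ) : Finset (Fin N) :=
  Finset.univ.filter fun j => s.baOut (e, j) = some true

/-- The retrieved block of instance `x`, decomposed; `none` if it is ill-formatted. -/
def content (P : Params N f Tx Data Chunk Digest) (s : NodeState N Tx Data Chunk Digest)
    (x : Inst N) : Option (List Tx × (Fin N → ℕ∞)) :=
  match (s.client x).result with
  | some (.block B) => P.format.parse B
  | _ => none

/-- The observation array in the retrieved block of instance `x`, `[∞, …, ∞]` if the block is
ill-formatted. -/
def reported (P : Params N f Tx Data Chunk Digest) (s : NodeState N Tx Data Chunk Digest)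
    (x : Inst N) : Fin N → ℕ∞ :=
  match s.content P x with
  | some (_, V) => V
  | none => fun _ => ⊤

/-- `E^e[j]`: the `(f+1)`-th largest of the values reported for `j` in the blocks of `S^e`. -/
def estimate (P : Params N f Tx Data Chunk Digest) (s : NodeState N Tx Data Chunk Digest)
    (e : ℕ) (j : Fin N) : ℕ∞ :=
  (((s.selected e).val.map fun k => s.reported P (e, k) j).sort (· ≥ ·)).getD f 0

/-- Entry of the log for the block of instance `x`. -/
def entry (P : Params N f Tx Data Chunk Digest) (s : NodeState N Tx Data Chunk Digest)
    (x : Inst N) : Inst N × Option (List Tx) :=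
  (x, (s.content P x).map Prod.fst)

end NodeState

/-! ### The system -/

/-- A message in the network; sender and instance are authenticated. -/
structure Packet (N : ℕ) (Chunk Digest : Type*) where
  src : Fin N
  dst : Fin N
  inst : Inst N
  msg : Msg Chunk Digest

/-- Global configuration: the local states (those of Byzantine nodes are never used) and the
messages sent so far by correct nodes. -/
structure Config (N : ℕ) (Tx Data Chunk Digest : Type*) where
  node : Fin N → NodeState N Tx Data Chunk Digest
  sent : Set (Packet N Chunk Digest)

/-- Nodes in their initial state, no message sent. -/
def Config.initial : Config N Tx Data Chunk Digest := ⟨fun _ => NodeState.initial, ∅⟩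

/-- Node `i` changes its state to `s` and sends the messages `out` of the VID instance `x`. -/
def Config.update (c : Config N Tx Data Chunk Digest) (i : Fin N)
    (s : NodeState N Tx Data Chunk Digest) (x : Inst N) (out : Set (Fin N × Msg Chunk Digest)) :
    Config N Tx Data Chunk Digest where
  node := Function.update c.node i s
  sent := c.sent ∪ {q | q.src = i ∧ q.inst = x ∧ (q.dst, q.msg) ∈ out}

/-- Node `i` changes its state to `s` and sends nothing. -/
def Config.setNode (c : Config N Tx Data Chunk Digest) (i : Fin N)
    (s : NodeState N Tx Data Chunk Digest) : Config N Tx Data Chunk Digest :=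
  { c with node := Function.update c.node i s }

/-- The atomic actions of the system. -/
inductive Action (N : ℕ) (Chunk Digest : Type*)
  /-- nothing happens -/
  | idle
  /-- node `dst` receives a message of the VID instance `x` from node `src` -/
  | recv (src dst : Fin N) (x : Inst N) (m : Msg Chunk Digest)
  /-- the BA instance `x` gives `Output(b)` at node `i` -/
  | baOutput (i : Fin N) (x : Inst N) (b : Bool)
  /-- dispersal phase, steps 1 and 2 -/
  | disperse (i : Fin N)
  /-- dispersal phase: `Input(1)` on the BA instance `x` upon `Complete` of the VID instance `x` -/
  | inputOne (i : Fin N) (x : Inst N)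
  /-- dispersal phase: `Input(0)` on all remaining BA instances of the epoch -/
  | inputZero (i : Fin N)
  /-- end of the dispersal phase, and start of the next epoch's dispersal phase -/
  | nextEpoch (i : Fin N)
  /-- `Retrieve` is invoked on the VID instance `x` -/
  | retrieve (i : Fin N) (x : Inst N)
  /-- retrieval phase, steps 2 to 4, once the blocks selected by BA are there -/
  | deliverSelected (i : Fin N)
  /-- retrieval phase, step 5, once the blocks selected by inter-node linking are there -/
  | deliverLinked (i : Fin N)

/-- `Step P H c a c'`: with set `H` of correct nodes, action `a` can lead from `c` to `c'`.
Only steps of correct nodes are recorded; a message from a Byzantine node can be received at any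
time and is arbitrary, a message from a correct node must have been sent to the receiver. -/
def Step (P : Params N f Tx Data Chunk Digest) (H : Finset (Fin N))
    (c : Config N Tx Data Chunk Digest) (a : Action N Chunk Digest)
    (c' : Config N Tx Data Chunk Digest) : Prop :=
  match a with
  | .idle => c' = c
  | .recv src dst x m =>
      dst ∈ H ∧ (src ∈ H → ⟨src, dst, x, m⟩ ∈ c.sent) ∧
      let s := c.node dst
      let r := serverHandler P dst x src (s.server x) m
      c' = c.update dst
        { s with
          server := Function.update s.server x r.1
          client := Function.update s.client x (clientHandler P src (s.client x) m) }
        x (r.2 ∪ r.1.answers)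
  | .baOutput i x b =>
      let s := c.node i
      i ∈ H ∧ s.baOut x = none ∧
      c' = c.setNode i { s with baOut := Function.update s.baOut x (some b) }
  | .disperse i =>
      let s := c.node i
      i ∈ H ∧ s.proposed s.epoch = none ∧ ∃ T : List Tx,
        let B := P.format.serialize T s.observation
        let C := P.code.encode B
        c' = c.update i { s with proposed := Function.update s.proposed s.epoch (some B) }
          (s.epoch, i) {q | q.2 = .chunk (P.merkleRoot C) (C q.1) (P.merkleProof C q.1)}
  | .inputOne i x =>
      let s := c.node i
      i ∈ H ∧ x.1 = s.epoch ∧ s.proposed s.epoch ≠ none ∧ s.Completed x ∧ s.baIn x = none ∧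
      c' = c.setNode i { s with baIn := Function.update s.baIn x (some true) }
  | .inputZero i =>
      let s := c.node i
      i ∈ H ∧ s.proposed s.epoch ≠ none ∧ N - f ≤ (s.selected s.epoch).card ∧
      (∃ j, s.baIn (s.epoch, j) = none) ∧
      c' = c.setNode i
        { s with
          baIn := fun x => if x.1 = s.epoch ∧ s.baIn x = none then some false else s.baIn x }
  | .nextEpoch i =>
      let s := c.node i
      i ∈ H ∧ s.proposed s.epoch ≠ none ∧ (∀ j, s.baOut (s.epoch, j) ≠ none) ∧
      c' = c.setNode i { s with epoch := s.epoch + 1 }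
  | .retrieve i x =>
      let s := c.node i
      i ∈ H ∧ ¬ (s.client x).invoked ∧
      ((x.1 < s.epoch ∧ x.2 ∈ s.selected x.1) ∨ ∃ L, s.linking = some L ∧ x ∈ L) ∧
      c' = c.update i
        { s with client := Function.update s.client x { s.client x with invoked := True } }
        x (toAll .requestChunk)
  | .deliverSelected i =>
      let s := c.node i
      let e := s.finished + 1
      let D := s.delivered ∪ {x | x.1 = e ∧ x.2 ∈ s.selected e}
      let L := {x : Inst N | 1 ≤ x.1 ∧ (x.1 : ℕ∞) ≤ s.estimate P e x.2 ∧ x ∉ D}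
      i ∈ H ∧ s.linking = none ∧ e < s.epoch ∧ (∀ j ∈ s.selected e, s.HasRetrieved (e, j)) ∧
      c' = c.setNode i
        { s with
          log := s.log ++
            ((List.finRange N).filter (· ∈ s.selected e)).map fun j => s.entry P (e, j)
          delivered := D ∪ L
          linking := some L }
  | .deliverLinked i =>
      let s := c.node i
      i ∈ H ∧ ∃ (L : Set (Inst N)) (l : List (Inst N)),
        s.linking = some L ∧ (∀ x ∈ L, s.HasRetrieved x) ∧
        (∀ x, x ∈ l ↔ x ∈ L) ∧
        l.Pairwise (fun x y => x.1 < y.1 ∨ (x.1 = y.1 ∧ x.2 < y.2)) ∧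
        c' = c.setNode i
          { s with
            log := s.log ++ l.map (s.entry P)
            linking := none
            finished := s.finished + 1 }

/-- The steps of the protocol, which correct nodes must take eventually when they stay possible. -/
def Action.IsLocal : Action N Chunk Digest → Prop
  | .idle => False
  | .recv _ _ _ _ => False
  | .baOutput _ _ _ => False
  | _ => True

/-- A run of the protocol with set `H` of correct nodes in an asynchronous network: delays are
arbitrary, but messages between correct nodes are eventually received, and correct nodes
eventually take the steps that stay possible. -/
structure Execution (P : Params N f Tx Data Chunk Digest) (H : Finset (Fin N)) where
  cfg : ℕ → Config N Tx Data Chunk Digest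
  act : ℕ → Action N Chunk Digest
  init : cfg 0 = Config.initial
  step : ∀ t, Step P H (cfg t) (act t) (cfg (t + 1))
  delivery : ∀ t, ∀ q ∈ (cfg t).sent, q.dst ∈ H → ∃ t', act t' = .recv q.src q.dst q.inst q.msg
  fair : ∀ a : Action N Chunk Digest, a.IsLocal → ∀ t,
    (∀ t' ≥ t, ∃ c', Step P H (cfg t') a c') → ∃ t' ≥ t, act t' = a

namespace Execution

variable {P : Params N f Tx Data Chunk Digest} {H : Finset (Fin N)}

/-- The state of node `i` at time `t`. -/
def state (R : Execution P H) (t : ℕ) (i : Fin N) : NodeState N Tx Data Chunk Digest :=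
  (R.cfg t).node i

/-- The defining properties of binary agreement, for the BA instance `x`. -/
structure IsBinaryAgreement (R : Execution P H) (x : Inst N) : Prop where
  /-- If all correct nodes invoke `Input`, then every correct node eventually gets an `Output`. -/
  termination : (∀ i ∈ H, ∃ t, (R.state t i).baIn x ≠ none) →
    ∀ i ∈ H, ∃ t, (R.state t i).baOut x ≠ none
  /-- If a correct node gets `Output(b)`, then every correct node eventually gets `Output(b)`. -/
  agreement : ∀ b, ∀ i ∈ H, ∀ t, (R.state t i).baOut x = some b →
    ∀ j ∈ H, ∃ t', (R.state t' j).baOut x = some b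
  /-- If a correct node gets `Output(b)`, then a correct node has invoked `Input(b)`. -/
  validity : ∀ b, ∀ i ∈ H, ∀ t, (R.state t i).baOut x = some b →
    ∃ j ∈ H, (R.state t j).baIn x = some b

/-- The chunks hashed in the run when correct nodes disperse their blocks or check proofs. -/
def leafQueries (R : Execution P H) : Set Chunk :=
  {c | ∃ t src dst x r p, R.act t = .recv src dst x (.chunk r c p)} ∪
  {c | ∃ t src dst x r p, R.act t = .recv src dst x (.returnChunk r c p)} ∪
  {c | ∃ t i e B j, i ∈ H ∧ (R.state t i).proposed e = some B ∧ c = P.code.encode B j}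

/-- The pairs of digests hashed in the run when correct nodes disperse their blocks or check
proofs. -/
def nodeQueries (R : Execution P H) : Set (Digest × Digest) :=
  {q | ∃ t src dst x r c p, R.act t = .recv src dst x (.chunk r c p) ∧
    q ∈ pathQueries P.hash.node P.depth dst (P.hash.leaf c) p} ∪
  {q | ∃ t src dst x r c p, R.act t = .recv src dst x (.returnChunk r c p) ∧
    q ∈ pathQueries P.hash.node P.depth src (P.hash.leaf c) p} ∪
  {q | ∃ t i e B, i ∈ H ∧ (R.state t i).proposed e = some B ∧
    q ∈ treeQueries P.hash.node P.depth (P.leaves (P.code.encode B))}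

/-- Security of the hash functions: no collision shows up in the run. -/
def NoHashCollision (R : Execution P H) : Prop :=
  Set.InjOn P.hash.leaf R.leafQueries ∧
  Set.InjOn (fun q : Digest × Digest => P.hash.node q.1 q.2) R.nodeQueries

end Execution

end

end DispersedLedger

namespace DispersedLedger

noncomputable section

open scoped Classical

/-! ### Merkle trees -/

section Merkle

variable {Digest : Type*} (node : Digest → Digest → Digest)

/-! The relevant local information only grows (`NodeState.Extends`), so finitely many persistent
eventualities hold at a common time (`exists_forall_mem_of_monotone`), and a step that stays enabled
until its goal holds does reach that goal (`eventually_of_fair`). Three arguments rest on this.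

Dispersal is quorum counting with `N ≥ 3f + 1`. Every `Ready(r)` of a correct node goes back to `N -
f` votes `GotChunk(r)` at some node (`ready_sent`). Two such quorums share a correct node, which
votes for one root only, so correct nodes never send `Ready` for different roots (`ready_unique`).
Hence a correct node's proposal completes at all correct nodes (`eventually_completed_of_proposed`),
and completion at one node spreads to all correct ones, with `N - 2f` correct holders of chunks
under the common root (`eventually_chunkRoot_of_completed`). Those holders answer, so an invoked
retrieval finishes (`eventually_hasRetrieved`).

Within an epoch, suppose no correct node ever saw `N - f` outputs `1`. Then none inputs `0`, every
output is `1` by validity, and nobody leaves the epoch. All correct proposals complete, all correct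
nodes input `1` on them, and these at least `N - f` instances output `1`: a contradiction
(`exists_card_selected`). Agreement spreads the outputs, input `0` fills the remaining instances,
and termination gives all outputs (`eventually_baOut`); induction on the epoch gives
`eventually_epoch`.

For retrieval, an instance selected by BA has input `1` from a correct node, so it has completed
there. Among the `f + 1` largest reports one comes from a correct node. In the absence of hash
collisions the block retrieved from that node is the one it proposed (`result_eq_of_correct`), so
its report is a genuine observation: finite, and covering only completed instances. The linked
instances are thus finitely many and all retrievable, and the count of finished epochs keeps growing
(`eventually_finished_succ`). -/

theorem pathRoot_treeProof (d : ℕ) (a : ℕ → Digest) (i : ℕ) (hi : i < 2 ^ d) :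
    pathRoot node d i (a i) (treeProof node d a i) = some (treeRoot node d a) := by
  induction d generalizing a i with
  | zero =>
    obtain rfl : i = 0 := by simpa using hi
    simp [treeProof, treeRoot, pathRoot]
  | succ d ih =>
    by_cases h : i < 2 ^ d
    · simp [treeProof, pathRoot, h, treeRoot, ih a i h]
    · have h2 : i - 2 ^ d < 2 ^ d := by rw [pow_succ] at hi; omega
      have := ih (fun k => a (k + 2 ^ d)) (i - 2 ^ d) h2
      rw [Nat.sub_add_cancel (not_lt.1 h)] at this
      simp [treeProof, pathRoot, h, treeRoot, this]

/-- Without collisions, a valid path to the root of a tree starts at a leaf of that tree. -/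
theorem eq_leaf_of_pathRoot_eq {S : Set (Digest × Digest)}
    (hS : Set.InjOn (fun q : Digest × Digest => node q.1 q.2) S)
    (d : ℕ) (a : ℕ → Digest) (i : ℕ) (hi : i < 2 ^ d) (y : Digest) (p : List Digest)
    (hp : pathQueries node d i y p ⊆ S) (ha : treeQueries node d a ⊆ S)
    (h : pathRoot node d i y p = some (treeRoot node d a)) : y = a i := by
  induction d generalizing a i p with
  | zero =>
    obtain rfl : i = 0 := by simpa using hi
    cases p <;> simp_all [pathRoot, treeRoot]
  | succ d ih =>
    cases p with
    | nil => simp [pathRoot] at h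
    | cons s p =>
      simp only [treeQueries, Set.union_subset_iff, Set.singleton_subset_iff] at ha
      obtain ⟨ha0, ha1, ha2⟩ := ha
      by_cases hd : i < 2 ^ d
      · simp only [pathRoot, hd, if_true, Option.map_eq_some_iff, treeRoot] at h
        simp only [pathQueries, hd, if_true, Set.union_subset_iff] at hp
        obtain ⟨z, hz, hzs⟩ := h
        -- The last hash on the path and the hash at the root of the tree have equal values;
        -- injectivity on the queries identifies both children, and the induction continues in the
        -- subtree containing `i`.
        have := hS (hp.1 (show (z, s) ∈ _ from ⟨hz, rfl⟩)) ha0 hzs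
        simp only [Prod.mk.injEq] at this
        exact ih a i hd p hp.2 ha1 (by rw [hz, this.1])
      · have h2 : i - 2 ^ d < 2 ^ d := by rw [pow_succ] at hi; omega
        simp only [pathRoot, hd, if_false, Option.map_eq_some_iff, treeRoot] at h
        simp only [pathQueries, hd, if_false, Set.union_subset_iff] at hp
        obtain ⟨z, hz, hzs⟩ := h
        have := hS (hp.1 (show (s, z) ∈ _ from ⟨rfl, hz⟩)) ha0 hzs
        simp only [Prod.mk.injEq] at this
        have := ih (fun k => a (k + 2 ^ d)) _ h2 p hp.2 ha2 (by rw [hz, this.2])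
        simpa [Nat.sub_add_cancel (not_lt.1 hd)] using this

end Merkle

variable {N f : ℕ} {Tx Data Chunk Digest : Type*}

namespace Params

variable (P : Params N f Tx Data Chunk Digest)

theorem lt_two_pow_depth (i : Fin N) : (i : ℕ) < 2 ^ P.depth :=
  i.2.trans_le (Nat.le_pow_clog one_lt_two N)

theorem leaves_coe (C : Fin N → Chunk) (i : Fin N) : P.leaves C i = P.hash.leaf (C i) := by
  simp [leaves]

theorem verify_merkleProof (C : Fin N → Chunk) (i : Fin N) :
    P.Verify (P.merkleRoot C) i (C i) (P.merkleProof C i) := by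
  have := pathRoot_treeProof P.hash.node P.depth (P.leaves C) i (P.lt_two_pow_depth i)
  rwa [leaves_coe] at this

end Params

/-! ### Counting -/

/-- A set disjoint from `H` fits into the at most `f` remaining nodes. -/
theorem exists_mem_of_lt_card {H : Finset (Fin N)} (hH : N ≤ H.card + f) {A : Finset (Fin N)}
    (hA : f + 1 ≤ A.card) : ∃ k ∈ A, k ∈ H := by
  by_contra! h
  have hd : Disjoint A H := Finset.disjoint_left.2 h
  have := Finset.card_le_univ (A ∪ H)
  rw [Finset.card_union_of_disjoint hd, Fintype.card_fin] at this
  omega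

theorem card_le_card_inter_add {H : Finset (Fin N)} (hH : N ≤ H.card + f) (A : Finset (Fin N)) :
    A.card ≤ (A ∩ H).card + f := by
  have h1 := Finset.card_union_add_card_inter A H
  have h2 := Finset.card_le_univ (A ∪ H)
  rw [Fintype.card_fin] at h2
  omega

/-- In a decreasing list the first `f + 1` entries all dominate the entry at index `f`. The
alternative `0` is the default value, taken when there are at most `f` entries. -/
theorem getD_sort_eq_zero_or_le {ι : Type*} (S : Finset ι) (g : ι → ℕ∞) (f : ℕ) :
    ((S.val.map g).sort (· ≥ ·)).getD f 0 = 0 ∨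
      f + 1 ≤ (S.filter fun k => ((S.val.map g).sort (· ≥ ·)).getD f 0 ≤ g k).card := by
  set l := (S.val.map g).sort (· ≥ ·) with hl
  by_cases hf : f < l.length
  · right
    rw [List.getD_eq_getElem _ _ hf]
    have hs : l.Pairwise (· ≥ ·) := Multiset.pairwise_sort _ _
    have h1 : ((S.filter fun k => l[f] ≤ g k).card) = l.countP (fun v => l[f] ≤ v) := by
      have : (l : Multiset ℕ∞) = S.val.map g := Multiset.sort_eq _ _
      rw [← Multiset.coe_countP, this, Multiset.countP_map]
      rfl
    rw [h1]
    have h2 : (l.take (f + 1)).countP (fun v => l[f] ≤ v) = f + 1 := by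
      rw [List.countP_eq_length.2]
      · simp; omega
      · intro a ha
        obtain ⟨n, hn, rfl⟩ := List.getElem_of_mem ha
        simp only [List.length_take] at hn
        simp only [List.getElem_take, decide_eq_true_eq]
        rcases (show n ≤ f by omega).eq_or_lt with rfl | h
        · exact le_rfl
        · exact List.pairwise_iff_getElem.1 hs n f _ hf h
    calc f + 1 = _ := h2.symm
      _ ≤ _ := (List.take_sublist _ _).countP_le
  · left
    exact List.getD_eq_default _ _ (not_lt.1 hf)

/-- Eventualities that persist happen simultaneously. -/
theorem exists_forall_mem_of_monotone {ι : Type*} {s : Set ι} (hs : s.Finite) {p : ι → ℕ → Prop}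
    (hp : ∀ j ∈ s, ∀ t t', t ≤ t' → p j t → p j t') (h : ∀ j ∈ s, ∃ t, p j t) :
    ∃ t, ∀ j ∈ s, p j t := by
  choose! g hg using h
  obtain ⟨M, hM⟩ := (hs.image g).bddAbove
  exact ⟨M, fun j hj => hp j hj _ _ (hM ⟨j, hj, rfl⟩) (hg j hj)⟩

/-- A finite set of instances can be listed by epoch and node. -/
theorem exists_sorted_list {L : Set (Inst N)} (hL : L.Finite) :
    ∃ l : List (Inst N), (∀ x, x ∈ l ↔ x ∈ L) ∧
      l.Pairwise fun x y => x.1 < y.1 ∨ (x.1 = y.1 ∧ x.2 < y.2) := by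
  -- The order by epoch and then node is the lexicographic order, so sorting in `ℕ ×ₗ Fin N` gives
  -- the list.
  let S : Finset (ℕ ×ₗ Fin N) := hL.toFinset.map toLex.toEmbedding
  refine ⟨(S.sort (· ≤ ·)).map ofLex, fun x => ?_, ?_⟩
  · simp [S]
  · rw [List.pairwise_map]
    refine (S.sortedLT_sort).pairwise.imp ?_
    intro a b hab
    exact Prod.Lex.lt_iff.1 hab

/-! ### Observations -/

namespace NodeState

variable {s : NodeState N Tx Data Chunk Digest}

theorem completed_of_le_observation {j : Fin N} {d : ℕ} (hd : 1 ≤ d)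
    (h : (d : ℕ∞) ≤ s.observation j) : s.Completed (d, j) := by
  by_contra hc
  have : s.observation j ≤ ((d - 1 : ℕ) : ℕ∞) := by
    refine iSup₂_le fun t ht => ?_
    have : t < d := by
      by_contra! h'
      exact hc (ht d hd h')
    exact_mod_cast (show t ≤ d - 1 by omega)
  have : d ≤ d - 1 := by exact_mod_cast h.trans this
  omega

/-- An infinite observation would mean that all epochs of node `j` have completed. The supremum can
be `⊤` in general; finiteness at each time is supplied by `finite_completed`. -/
theorem observation_ne_top (h : {x | s.Completed x}.Finite) (j : Fin N) :
    s.observation j ≠ ⊤ := by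
  intro hj
  have hinj : Function.Injective fun d : ℕ => ((d + 1, j) : Inst N) := fun a b hab => by
    simpa using hab
  refine Set.infinite_of_injective_forall_mem hinj (fun d => ?_) h
  exact completed_of_le_observation (by omega) (by rw [hj]; exact le_top)

/-- At least `f + 1` selected blocks report a value no smaller than the estimate, and they cannot
all come from faulty nodes. This is why the `(f+1)`-th largest value is used. -/
theorem exists_estimate_le (P : Params N f Tx Data Chunk Digest) {H : Finset (Fin N)}
    (hH : N ≤ H.card + f) (e : ℕ) (j : Fin N) :
    s.estimate P e j = 0 ∨
      ∃ k ∈ s.selected e, k ∈ H ∧ s.estimate P e j ≤ s.reported P (e, k) j := by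
  refine (getD_sort_eq_zero_or_le (s.selected e) (fun k => s.reported P (e, k) j) f).imp id ?_
  intro h
  obtain ⟨k, hk, hkH⟩ := exists_mem_of_lt_card hH h
  rw [Finset.mem_filter] at hk
  exact ⟨k, hk.1, hkH, hk.2⟩

end NodeState

/-! ### The effect of a step on a single node -/

/-- The changes of the local state of node `i` that action `a` can cause. -/
inductive LocalStep (P : Params N f Tx Data Chunk Digest) (i : Fin N)
    (s : NodeState N Tx Data Chunk Digest) :
    Action N Chunk Digest → NodeState N Tx Data Chunk Digest → Prop
  | recv (src : Fin N) (x : Inst N) (m : Msg Chunk Digest) :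
      LocalStep P i s (.recv src i x m)
        { s with
          server := Function.update s.server x (serverHandler P i x src (s.server x) m).1
          client := Function.update s.client x (clientHandler P src (s.client x) m) }
  | baOutput (x : Inst N) (b : Bool) (h : s.baOut x = none) :
      LocalStep P i s (.baOutput i x b) { s with baOut := Function.update s.baOut x (some b) }
  | disperse (h : s.proposed s.epoch = none) (T : List Tx) :
      LocalStep P i s (.disperse i)
        { s with
          proposed := Function.update s.proposed s.epoch
            (some (P.format.serialize T s.observation)) }
  | inputOne (x : Inst N) (hx : x.1 = s.epoch) (hp : s.proposed s.epoch ≠ none)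
      (hc : s.Completed x) (h : s.baIn x = none) :
      LocalStep P i s (.inputOne i x) { s with baIn := Function.update s.baIn x (some true) }
  | inputZero (hp : s.proposed s.epoch ≠ none) (hc : N - f ≤ (s.selected s.epoch).card)
      (h : ∃ j, s.baIn (s.epoch, j) = none) :
      LocalStep P i s (.inputZero i)
        { s with
          baIn := fun x => if x.1 = s.epoch ∧ s.baIn x = none then some false else s.baIn x }
  | nextEpoch (hp : s.proposed s.epoch ≠ none) (h : ∀ j, s.baOut (s.epoch, j) ≠ none) :
      LocalStep P i s (.nextEpoch i) { s with epoch := s.epoch + 1 }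
  | retrieve (x : Inst N) (h : ¬ (s.client x).invoked) :
      LocalStep P i s (.retrieve i x)
        { s with client := Function.update s.client x { s.client x with invoked := True } }
  | deliverSelected (h : s.linking = none) (he : s.finished + 1 < s.epoch)
      (hr : ∀ j ∈ s.selected (s.finished + 1), s.HasRetrieved (s.finished + 1, j))
      (log : List (Inst N × Option (List Tx))) (D L : Set (Inst N))
      (hD : D = s.delivered ∪ {x | x.1 = s.finished + 1 ∧ x.2 ∈ s.selected (s.finished + 1)})
      (hL : L = {x : Inst N |
        1 ≤ x.1 ∧ (x.1 : ℕ∞) ≤ s.estimate P (s.finished + 1) x.2 ∧ x ∉ D}) :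
      LocalStep P i s (.deliverSelected i)
        { s with log := log, delivered := D ∪ L, linking := some L }
  | deliverLinked (L : Set (Inst N)) (h : s.linking = some L) (hr : ∀ x ∈ L, s.HasRetrieved x)
      (log : List (Inst N × Option (List Tx))) :
      LocalStep P i s (.deliverLinked i)
        { s with log := log, linking := none, finished := s.finished + 1 }

/-- The information in `s` is preserved in `s'`. -/
structure NodeState.Extends (s s' : NodeState N Tx Data Chunk Digest) : Prop where
  mine : ∀ x v, (s.server x).mine = some v → (s'.server x).mine = some v
  gotFrom : ∀ x j v, (s.server x).gotFrom j = some v → (s'.server x).gotFrom j = some v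
  readyFrom : ∀ x j v, (s.server x).readyFrom j = some v → (s'.server x).readyFrom j = some v
  chunkRoot : ∀ x, (s.server x).chunkRoot ≠ none → (s'.server x).chunkRoot ≠ none
  requests : ∀ x, (s.server x).requests ⊆ (s'.server x).requests
  invoked : ∀ x, (s.client x).invoked → (s'.client x).invoked
  chunks : ∀ x j v, (s.client x).chunks j = some v → (s'.client x).chunks j = some v
  result : ∀ x v, (s.client x).result = some v → (s'.client x).result = some v
  baIn : ∀ x b, s.baIn x = some b → s'.baIn x = some b
  baOut : ∀ x b, s.baOut x = some b → s'.baOut x = some b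
  epoch : s.epoch ≤ s'.epoch
  proposed : ∀ e B, s.proposed e = some B → s'.proposed e = some B
  finished : s.finished ≤ s'.finished
  delivered : s.delivered ⊆ s'.delivered

namespace NodeState.Extends

variable {s s' s'' : NodeState N Tx Data Chunk Digest}

theorem refl (s : NodeState N Tx Data Chunk Digest) : s.Extends s := by
  constructor <;> simp

theorem trans (h : s.Extends s') (h' : s'.Extends s'') : s.Extends s'' where
  mine x v hv := h'.mine x v (h.mine x v hv)
  gotFrom x j v hv := h'.gotFrom x j v (h.gotFrom x j v hv)
  readyFrom x j v hv := h'.readyFrom x j v (h.readyFrom x j v hv)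
  chunkRoot x hv := h'.chunkRoot x (h.chunkRoot x hv)
  requests x := (h.requests x).trans (h'.requests x)
  invoked x hv := h'.invoked x (h.invoked x hv)
  chunks x j v hv := h'.chunks x j v (h.chunks x j v hv)
  result x v hv := h'.result x v (h.result x v hv)
  baIn x v hv := h'.baIn x v (h.baIn x v hv)
  baOut x v hv := h'.baOut x v (h.baOut x v hv)
  epoch := h.epoch.trans h'.epoch
  proposed e B hv := h'.proposed e B (h.proposed e B hv)
  finished := h.finished.trans h'.finished
  delivered := h.delivered.trans h'.delivered

theorem completed (h : s.Extends s') {x : Inst N} (hx : s.Completed x) : s'.Completed x :=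
  h.chunkRoot x hx

theorem hasRetrieved (h : s.Extends s') {x : Inst N} (hx : s.HasRetrieved x) :
    s'.HasRetrieved x := by
  obtain ⟨v, hv⟩ := Option.ne_none_iff_exists'.1 hx
  exact Option.ne_none_iff_exists'.2 ⟨v, h.result x v hv⟩

theorem baOut_ne (h : s.Extends s') {x : Inst N} (hx : s.baOut x ≠ none) :
    s'.baOut x ≠ none := by
  obtain ⟨v, hv⟩ := Option.ne_none_iff_exists'.1 hx
  exact Option.ne_none_iff_exists'.2 ⟨v, h.baOut x v hv⟩

theorem proposed_ne (h : s.Extends s') {e : ℕ} (hx : s.proposed e ≠ none) :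
    s'.proposed e ≠ none := by
  obtain ⟨v, hv⟩ := Option.ne_none_iff_exists'.1 hx
  exact Option.ne_none_iff_exists'.2 ⟨v, h.proposed e v hv⟩

theorem selected (h : s.Extends s') (e : ℕ) : s.selected e ⊆ s'.selected e := by
  intro j
  simp only [NodeState.selected, Finset.mem_filter, Finset.mem_univ, true_and]
  exact h.baOut _ _

theorem selected_card (h : s.Extends s') (e : ℕ) :
    (s.selected e).card ≤ (s'.selected e).card :=
  Finset.card_le_card (h.selected e)

theorem shareCount (h : s.Extends s') (x : Inst N) (r : Digest) :
    (s.server x).shareCount r ≤ (s'.server x).shareCount r :=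
  Finset.card_le_card fun j hj => by
    simp only [Finset.mem_filter, Finset.mem_univ, true_and] at hj ⊢
    exact h.gotFrom _ _ _ hj

theorem readyCount (h : s.Extends s') (x : Inst N) (r : Digest) :
    (s.server x).readyCount r ≤ (s'.server x).readyCount r :=
  Finset.card_le_card fun j hj => by
    simp only [Finset.mem_filter, Finset.mem_univ, true_and] at hj ⊢
    exact h.readyFrom _ _ _ hj

end NodeState.Extends

theorem update_eq_some {α β : Type*} [DecidableEq α] {g : α → Option β} {a : α} (h : g a = none)
    {w : Option β} {b : α} {v : β} (hb : g b = some v) : Function.update g a w b = some v := by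
  have : b ≠ a := by rintro rfl; simp [h] at hb
  simpa [this] using hb

/-- What a server keeps when it handles a message. -/
theorem serverHandler_extends (P : Params N f Tx Data Chunk Digest) (me : Fin N) (x : Inst N)
    (src : Fin N) (s : ServerState N Chunk Digest) (m : Msg Chunk Digest) :
    (∀ v, s.mine = some v → (serverHandler P me x src s m).1.mine = some v) ∧
    (∀ j v, s.gotFrom j = some v → (serverHandler P me x src s m).1.gotFrom j = some v) ∧
    (∀ j v, s.readyFrom j = some v → (serverHandler P me x src s m).1.readyFrom j = some v) ∧
    (s.chunkRoot ≠ none → (serverHandler P me x src s m).1.chunkRoot ≠ none) ∧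
    s.requests ⊆ (serverHandler P me x src s m).1.requests := by
  cases m with
  | chunk r c p =>
    simp only [serverHandler]
    split_ifs with h
    · simp [h.2.2]
    · simp
  | gotChunk r =>
    by_cases h : s.gotFrom src = none
    · simp only [serverHandler, if_pos h]
      exact ⟨fun _ h => h, fun j v => update_eq_some h, fun _ _ h => h, fun h => h, subset_rfl⟩
    · simp [serverHandler, h]
  | ready r =>
    by_cases h : s.readyFrom src = none
    · simp only [serverHandler, if_pos h]
      refine ⟨fun _ h => h, fun _ _ h => h, fun j v => update_eq_some h, fun h => ?_, subset_rfl⟩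
      split_ifs
      · simp
      · exact h
    · simp [serverHandler, h]
  | requestChunk => simp [serverHandler]
  | returnChunk r c p => simp [serverHandler]

/-- What a client keeps when it handles a message. -/
theorem clientHandler_extends (P : Params N f Tx Data Chunk Digest)
    (src : Fin N) (s : ClientState N Data Chunk Digest) (m : Msg Chunk Digest) :
    (s.invoked → (clientHandler P src s m).invoked) ∧
    (∀ j v, s.chunks j = some v → (clientHandler P src s m).chunks j = some v) ∧
    (∀ v, s.result = some v → (clientHandler P src s m).result = some v) := by
  cases m with
  | returnChunk r c p =>
    simp only [clientHandler]
    split_ifs with h h'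
    · exact ⟨fun h => h, fun j v => update_eq_some h.2.2.2, fun v hv => by simp [h] at hv⟩
    · exact ⟨fun h => h, fun j v => update_eq_some h.2.2.2, fun v hv => hv⟩
    · simp
  | _ => simp [clientHandler]

/-- Partial fields are written only while they are `none`. The exception is `chunkRoot`, which the
handler may overwrite; only its being set is preserved here, and constancy of its value needs the
quorum argument of `ready_unique`. -/
theorem LocalStep.extends {P : Params N f Tx Data Chunk Digest} {i : Fin N}
    {s s' : NodeState N Tx Data Chunk Digest} {a : Action N Chunk Digest}
    (h : LocalStep P i s a s') : s.Extends s' := by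
  have key := NodeState.Extends.refl s
  cases h with
  | recv src x m =>
    have hs := serverHandler_extends P i x src (s.server x) m
    have hc := clientHandler_extends P src (s.client x) m
    constructor
    case mine =>
      intro y v hv
      by_cases hy : y = x
      · subst hy; simpa using hs.1 v hv
      · simpa [hy] using hv
    case gotFrom =>
      intro y j v hv
      by_cases hy : y = x
      · subst hy; simpa using hs.2.1 j v hv
      · simpa [hy] using hv
    case readyFrom =>
      intro y j v hv
      by_cases hy : y = x
      · subst hy; simpa using hs.2.2.1 j v hv
      · simpa [hy] using hv
    case chunkRoot =>
      intro y hv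
      by_cases hy : y = x
      · subst hy; simpa using hs.2.2.2.1 hv
      · simpa [hy] using hv
    case requests =>
      intro y
      by_cases hy : y = x
      · subst hy; simpa using hs.2.2.2.2
      · simp [hy]
    case invoked =>
      intro y hv
      by_cases hy : y = x
      · subst hy; simpa using hc.1 hv
      · simpa [hy] using hv
    case chunks =>
      intro y j v hv
      by_cases hy : y = x
      · subst hy; simpa using hc.2.1 j v hv
      · simpa [hy] using hv
    case result =>
      intro y v hv
      by_cases hy : y = x
      · subst hy; simpa using hc.2.2 v hv
      · simpa [hy] using hv
    all_goals simp
  | baOutput x b h =>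
    exact { key with
      baOut := fun y v hv => by
        have : y ≠ x := by rintro rfl; simp [h] at hv
        simpa [this] using hv }
  | disperse h T =>
    exact { key with
      proposed := fun y v hv => by
        have : y ≠ s.epoch := by rintro rfl; simp [h] at hv
        simpa [this] using hv }
  | inputOne x hx hp hc h =>
    exact { key with
      baIn := fun y v hv => by
        have : y ≠ x := by rintro rfl; simp [h] at hv
        simpa [this] using hv }
  | inputZero hp hc h => exact { key with baIn := fun y v hv => by simp [hv] }
  | nextEpoch hp h => exact { key with epoch := Nat.le_succ _ }
  | retrieve x h =>
    exact { key with
      invoked := fun y hv => by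
        by_cases hy : y = x
        · subst hy; simp
        · simpa [hy] using hv
      chunks := fun y j v hv => by
        by_cases hy : y = x
        · subst hy; simpa using hv
        · simpa [hy] using hv
      result := fun y v hv => by
        by_cases hy : y = x
        · subst hy; simpa using hv
        · simpa [hy] using hv }
  | deliverSelected h he hr log D L hD hL =>
    exact { key with
      delivered := fun y hy => by
        simp only [hD]
        exact Or.inl (Or.inl hy) }
  | deliverLinked L h hr log => exact { key with finished := Nat.le_succ _ }

namespace Execution

variable {P : Params N f Tx Data Chunk Digest} {H : Finset (Fin N)} (R : Execution P H)

/-- An action changes the node it names and no other, and only correct nodes act. Later case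
analyses on one field go through this reduction instead of unfolding `Step`. -/
theorem state_succ (t : ℕ) (i : Fin N) :
    R.state (t + 1) i = R.state t i ∨ i ∈ H ∧ LocalStep P i (R.state t i) (R.act t)
      (R.state (t + 1) i) := by
  have h := R.step t
  simp only [state]
  cases hact : R.act t <;> rw [hact] at h <;> simp only [Step] at h
  case idle => left; rw [h]
  case recv src dst x m =>
    obtain ⟨hi, -, h⟩ := h
    rw [h]
    by_cases hd : i = dst
    · subst hd; right; refine ⟨hi, ?_⟩; simp only [Config.update, Function.update_self]
      exact LocalStep.recv src x m
    · left; simp [Config.update, hd]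
  case baOutput k x b =>
    obtain ⟨hi, hb, h⟩ := h
    rw [h]
    by_cases hd : i = k
    · subst hd; right; refine ⟨hi, ?_⟩; simp only [Config.setNode, Function.update_self]
      exact LocalStep.baOutput x b hb
    · left; simp [Config.setNode, hd]
  case disperse k =>
    obtain ⟨hi, hb, T, h⟩ := h
    rw [h]
    by_cases hd : i = k
    · subst hd; right; refine ⟨hi, ?_⟩; simp only [Config.update, Function.update_self]
      exact LocalStep.disperse hb T
    · left; simp [Config.update, hd]
  case inputOne k x =>
    obtain ⟨hi, h1, h2, h3, h4, h⟩ := h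
    rw [h]
    by_cases hd : i = k
    · subst hd; right; refine ⟨hi, ?_⟩; simp only [Config.setNode, Function.update_self]
      exact LocalStep.inputOne x h1 h2 h3 h4
    · left; simp [Config.setNode, hd]
  case inputZero k =>
    obtain ⟨hi, h1, h2, h3, h⟩ := h
    rw [h]
    by_cases hd : i = k
    · subst hd; right; refine ⟨hi, ?_⟩; simp only [Config.setNode, Function.update_self]
      exact LocalStep.inputZero h1 h2 h3
    · left; simp [Config.setNode, hd]
  case nextEpoch k =>
    obtain ⟨hi, h1, h2, h⟩ := h
    rw [h]
    by_cases hd : i = k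
    · subst hd; right; refine ⟨hi, ?_⟩; simp only [Config.setNode, Function.update_self]
      exact LocalStep.nextEpoch h1 h2
    · left; simp [Config.setNode, hd]
  case retrieve k x =>
    obtain ⟨hi, h1, h2, h⟩ := h
    rw [h]
    by_cases hd : i = k
    · subst hd; right; refine ⟨hi, ?_⟩; simp only [Config.update, Function.update_self]
      exact LocalStep.retrieve x h1
    · left; simp [Config.update, hd]
  case deliverSelected k =>
    obtain ⟨hi, h1, h2, h3, h⟩ := h
    rw [h]
    by_cases hd : i = k
    · subst hd; right; refine ⟨hi, ?_⟩; simp only [Config.setNode, Function.update_self]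
      exact LocalStep.deliverSelected h1 h2 h3 _ _ _ rfl rfl
    · left; simp [Config.setNode, hd]
  case deliverLinked k =>
    obtain ⟨hi, L, l, h1, h2, h3, h4, h⟩ := h
    rw [h]
    by_cases hd : i = k
    · subst hd; right; refine ⟨hi, ?_⟩; simp only [Config.setNode, Function.update_self]
      exact LocalStep.deliverLinked L h1 h2 _
    · left; simp [Config.setNode, hd]

theorem state_zero (i : Fin N) : R.state 0 i = NodeState.initial := by
  simp [state, R.init, Config.initial]

theorem extends_of_le {t t' : ℕ} (h : t ≤ t') (i : Fin N) :
    (R.state t i).Extends (R.state t' i) := by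
  induction h with
  | refl => exact .refl _
  | step h ih =>
    rename_i m
    refine ih.trans ?_
    rcases R.state_succ m i with h | h
    · rw [Nat.succ_eq_add_one, h]; exact .refl _
    · exact h.2.extends

theorem server_succ (t : ℕ) (i : Fin N) (x : Inst N) :
    (R.state (t + 1) i).server x = (R.state t i).server x ∨
      ∃ src m, R.act t = .recv src i x m ∧ i ∈ H ∧ (R.state (t + 1) i).server x =
        (serverHandler P i x src ((R.state t i).server x) m).1 := by
  rcases R.state_succ t i with h | ⟨hi, h⟩
  · left; rw [h]
  -- The successor state and the action are made variables so that `cases` can unify the indices of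
  -- `LocalStep`.
  generalize hs : R.state (t + 1) i = s' at h ⊢
  generalize ha : R.act t = a at h ⊢
  cases h
  case recv src y m =>
    by_cases hy : x = y
    · subst hy; right; exact ⟨src, m, rfl, hi, by simp⟩
    · left; simp [hy]
  all_goals exact .inl rfl

theorem client_succ (t : ℕ) (i : Fin N) (x : Inst N) :
    (R.state (t + 1) i).client x = (R.state t i).client x ∨
      (∃ src m, R.act t = .recv src i x m ∧ i ∈ H ∧ (R.state (t + 1) i).client x =
        clientHandler P src ((R.state t i).client x) m) ∨
      (R.act t = .retrieve i x ∧ (R.state (t + 1) i).client x =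
        { (R.state t i).client x with invoked := True }) := by
  rcases R.state_succ t i with h | ⟨hi, h⟩
  · left; rw [h]
  generalize hs : R.state (t + 1) i = s' at h ⊢
  generalize ha : R.act t = a at h ⊢
  cases h
  case recv src y m =>
    by_cases hy : x = y
    · subst hy; right; left; exact ⟨src, m, rfl, hi, by simp⟩
    · left; simp [hy]
  case retrieve y h =>
    by_cases hy : x = y
    · subst hy; right; right; exact ⟨rfl, by simp⟩
    · left; simp [hy]
  all_goals exact .inl rfl

theorem baIn_succ (t : ℕ) (i : Fin N) (x : Inst N) :
    (R.state (t + 1) i).baIn x = (R.state t i).baIn x ∨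
      ((R.state (t + 1) i).baIn x = some true ∧ (R.state t i).Completed x) ∨
      ((R.state (t + 1) i).baIn x = some false ∧
        N - f ≤ ((R.state t i).selected x.1).card) := by
  rcases R.state_succ t i with h | ⟨hi, h⟩
  · left; rw [h]
  generalize hs : R.state (t + 1) i = s' at h ⊢
  generalize ha : R.act t = a at h ⊢
  cases h
  case inputOne y _ _ hc _ =>
    by_cases hy : x = y
    · subst hy; right; left; exact ⟨by simp, hc⟩
    · left; simp [hy]
  case inputZero hp hc h =>
    by_cases hy : x.1 = (R.state t i).epoch ∧ (R.state t i).baIn x = none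
    · right; right; exact ⟨by simp [hy], by rw [hy.1]; exact hc⟩
    · left; simp only [hy, if_false]
  all_goals exact .inl rfl

theorem epoch_succ (t : ℕ) (i : Fin N) :
    (R.state (t + 1) i).epoch = (R.state t i).epoch ∨
      (R.state (t + 1) i).epoch = (R.state t i).epoch + 1 ∧
      (R.state t i).proposed (R.state t i).epoch ≠ none ∧
      ∀ j, (R.state t i).baOut ((R.state t i).epoch, j) ≠ none := by
  rcases R.state_succ t i with h | ⟨hi, h⟩
  · left; rw [h]
  generalize hs : R.state (t + 1) i = s' at h ⊢
  generalize ha : R.act t = a at h ⊢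
  cases h
  case nextEpoch hp h => exact .inr ⟨rfl, hp, h⟩
  all_goals exact .inl rfl

/-- Only the two delivery actions touch `linking`, `finished` and `delivered`. Their guards are
kept, since the invariants of the retrieval phase are read off from them. -/
theorem retrieval_succ (t : ℕ) (i : Fin N) :
    ((R.state (t + 1) i).linking = (R.state t i).linking ∧
      (R.state (t + 1) i).finished = (R.state t i).finished ∧
      (R.state (t + 1) i).delivered = (R.state t i).delivered) ∨
    (R.act t = .deliverSelected i ∧ (R.state t i).linking = none ∧
      (R.state t i).finished + 1 < (R.state t i).epoch ∧
      (∀ j ∈ (R.state t i).selected ((R.state t i).finished + 1),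
        (R.state t i).HasRetrieved ((R.state t i).finished + 1, j)) ∧
      (R.state (t + 1) i).finished = (R.state t i).finished ∧
      ∃ D L, D = (R.state t i).delivered ∪ {x | x.1 = (R.state t i).finished + 1 ∧
          x.2 ∈ (R.state t i).selected ((R.state t i).finished + 1)} ∧
        L = {x : Inst N | 1 ≤ x.1 ∧
          (x.1 : ℕ∞) ≤ (R.state t i).estimate P ((R.state t i).finished + 1) x.2 ∧ x ∉ D} ∧
        (R.state (t + 1) i).delivered = D ∪ L ∧ (R.state (t + 1) i).linking = some L) ∨
    (R.act t = .deliverLinked i ∧ (∃ L, (R.state t i).linking = some L ∧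
        ∀ x ∈ L, (R.state t i).HasRetrieved x) ∧
      (R.state (t + 1) i).linking = none ∧
      (R.state (t + 1) i).finished = (R.state t i).finished + 1 ∧
      (R.state (t + 1) i).delivered = (R.state t i).delivered) := by
  rcases R.state_succ t i with h | ⟨hi, h⟩
  · left; rw [h]; simp
  generalize hs : R.state (t + 1) i = s' at h ⊢
  generalize ha : R.act t = a at h ⊢
  cases h
  case deliverSelected h he hr log D L hD hL =>
    exact .inr (.inl ⟨rfl, h, he, hr, rfl, D, L, hD, hL, rfl, rfl⟩)
  case deliverLinked L h hr log =>
    exact .inr (.inr ⟨rfl, ⟨L, h, hr⟩, rfl, rfl, rfl⟩)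
  all_goals exact .inl ⟨rfl, rfl, rfl⟩

/-! ### Messages -/

theorem recv_spec {t : ℕ} {src dst : Fin N} {x : Inst N} {m : Msg Chunk Digest}
    (h : R.act t = .recv src dst x m) :
    dst ∈ H ∧ (src ∈ H → ⟨src, dst, x, m⟩ ∈ (R.cfg t).sent) ∧
      (R.state (t + 1) dst).server x =
        (serverHandler P dst x src ((R.state t dst).server x) m).1 ∧
      (R.state (t + 1) dst).client x = clientHandler P src ((R.state t dst).client x) m ∧
      (R.cfg (t + 1)).sent = (R.cfg t).sent ∪ {q | q.src = dst ∧ q.inst = x ∧ (q.dst, q.msg) ∈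
        (serverHandler P dst x src ((R.state t dst).server x) m).2 ∪
          (serverHandler P dst x src ((R.state t dst).server x) m).1.answers} := by
  have hs := R.step t
  rw [h] at hs
  obtain ⟨h1, h2, h3⟩ := hs
  refine ⟨h1, h2, ?_⟩
  simp only [state]
  rw [h3]
  simp [Config.update]

theorem proposed_succ (t : ℕ) (i : Fin N) (e : ℕ) :
    (R.state (t + 1) i).proposed e = (R.state t i).proposed e ∨
      ∃ T, (R.state (t + 1) i).proposed e =
          some (P.format.serialize T (R.state t i).observation) ∧
        ∀ k, (⟨i, k, (e, i), .chunk
          (P.merkleRoot (P.code.encode (P.format.serialize T (R.state t i).observation)))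
          (P.code.encode (P.format.serialize T (R.state t i).observation) k)
          (P.merkleProof (P.code.encode (P.format.serialize T (R.state t i).observation)) k)⟩ :
            Packet N Chunk Digest) ∈ (R.cfg (t + 1)).sent := by
  rcases R.state_succ t i with h | ⟨hi, h⟩
  · left; rw [h]
  generalize hs : R.state (t + 1) i = s' at h ⊢
  have hst := R.step t
  generalize ha : R.act t = a at h hst ⊢
  cases h
  case disperse hp T' =>
    by_cases he : e = (R.state t i).epoch
    · obtain ⟨-, -, T, h⟩ := hst
      right
      refine ⟨T, ?_, fun k => ?_⟩
      · rw [← hs]; simp only [state] at he ⊢; rw [h]; simp [Config.update, he]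
      · rw [h]; right; exact ⟨rfl, by rw [he]; rfl, rfl⟩
    · left; simp [he]
  all_goals exact .inl rfl

theorem sent_succ (t : ℕ) (q : Packet N Chunk Digest) (hq : q ∈ (R.cfg (t + 1)).sent) :
    q ∈ (R.cfg t).sent ∨
    (∃ src m, R.act t = .recv src q.src q.inst m ∧ (q.dst, q.msg) ∈
      (serverHandler P q.src q.inst src ((R.state t q.src).server q.inst) m).2 ∪
          (serverHandler P q.src q.inst src ((R.state t q.src).server q.inst) m).1.answers) ∨
    (∃ B, q.inst.2 = q.src ∧ (R.state (t + 1) q.src).proposed q.inst.1 = some B ∧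
      q.msg = .chunk (P.merkleRoot (P.code.encode B)) (P.code.encode B q.dst)
        (P.merkleProof (P.code.encode B) q.dst)) ∨
    (q.msg = .requestChunk ∧ ((R.state (t + 1) q.src).client q.inst).invoked) := by
  have h := R.step t
  cases hact : R.act t <;> rw [hact] at h <;> simp only [Step] at h
  case idle => left; rwa [h] at hq
  case recv src dst x m =>
    obtain ⟨-, -, h⟩ := h
    rw [h] at hq
    rcases hq with hq | ⟨rfl, rfl, hq⟩
    · exact .inl hq
    · exact .inr (.inl ⟨src, m, rfl, hq⟩)
  case disperse k =>
    obtain ⟨-, -, T, h⟩ := h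
    have hq' := hq
    rw [h] at hq'
    rcases hq' with hq' | ⟨rfl, hx, hq'⟩
    · exact .inl hq'
    · refine .inr (.inr (.inl ⟨_, by rw [hx], ?_, hq'⟩))
      simp only [state]
      rw [h, hx]
      simp [Config.update]
  case retrieve k x =>
    obtain ⟨-, -, -, h⟩ := h
    have hq' := hq
    rw [h] at hq'
    rcases hq' with hq' | ⟨rfl, rfl, hq'⟩
    · exact .inl hq'
    · refine .inr (.inr (.inr ⟨hq', ?_⟩))
      simp only [state]
      rw [h]
      simp [Config.update]
  case deliverLinked =>
    obtain ⟨-, L, l, -, -, -, -, h⟩ := h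
    left; rw [h] at hq; exact hq
  case baOutput => left; rw [h.2.2] at hq; exact hq
  case inputOne => left; rw [h.2.2.2.2.2] at hq; exact hq
  case inputZero => left; rw [h.2.2.2.2] at hq; exact hq
  case nextEpoch => left; rw [h.2.2.2] at hq; exact hq
  case deliverSelected => left; rw [h.2.2.2.2] at hq; exact hq

theorem sent_subset_succ (t : ℕ) : (R.cfg t).sent ⊆ (R.cfg (t + 1)).sent := by
  have h := R.step t
  cases hact : R.act t <;> rw [hact] at h <;> simp only [Step] at h
  case idle => rw [h]
  case recv => rw [h.2.2]; exact Set.subset_union_left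
  case disperse => obtain ⟨-, -, T, h⟩ := h; rw [h]; exact Set.subset_union_left
  case retrieve => rw [h.2.2.2]; exact Set.subset_union_left
  case deliverLinked => obtain ⟨-, L, l, -, -, -, -, h⟩ := h; rw [h]; exact subset_rfl
  case baOutput => rw [h.2.2]; exact subset_rfl
  case inputOne => rw [h.2.2.2.2.2]; exact subset_rfl
  case inputZero => rw [h.2.2.2.2]; exact subset_rfl
  case nextEpoch => rw [h.2.2.2]; exact subset_rfl
  case deliverSelected => rw [h.2.2.2.2]; exact subset_rfl

theorem sent_zero : (R.cfg 0).sent = ∅ := by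
  rw [R.init]; rfl

/-- A step which stays possible until `p` holds, and which establishes `p`, leads to `p`. -/
theorem eventually_of_fair {a : Action N Chunk Digest} (ha : a.IsLocal) {p : ℕ → Prop} (t : ℕ)
    (hen : ∀ t' ≥ t, ¬ p t' → ∃ c', Step P H (R.cfg t') a c')
    (hp : ∀ t' ≥ t, R.act t' = a → p (t' + 1)) : ∃ t' ≥ t, p t' := by
  -- If `p` failed from `t` on, the action would stay enabled, so fairness would execute it and
  -- thereby establish `p`.
  by_contra! h
  obtain ⟨t', ht', hact⟩ := R.fair a ha t fun t' ht' => hen t' ht' (h t' ht')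
  exact h (t' + 1) (by omega) (hp t' ht' hact)

end Execution

/-! ### The message handlers -/

section Handler

variable {P : Params N f Tx Data Chunk Digest} {me : Fin N} {x : Inst N} {src : Fin N}
  {s : ServerState N Chunk Digest} {m : Msg Chunk Digest}

theorem serverHandler_mine {v : Digest × Chunk × List Digest}
    (h : (serverHandler P me x src s m).1.mine = some v) :
    s.mine = some v ∨ m = .chunk v.1 v.2.1 v.2.2 ∧ src = x.2 ∧ P.Verify v.1 me v.2.1 v.2.2 ∧
      (serverHandler P me x src s m).2 = toAll (.gotChunk v.1) := by
  cases m with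
  | chunk r c p =>
    by_cases hc : src = x.2 ∧ P.Verify r me c p ∧ s.mine = none
    · simp only [serverHandler, if_pos hc, Option.some.injEq] at h ⊢
      subst h
      exact .inr ⟨rfl, hc.1, hc.2.1, rfl⟩
    · simp only [serverHandler, if_neg hc] at h
      exact .inl h
  | gotChunk r =>
    left; by_cases hc : s.gotFrom src = none <;> simpa [serverHandler, hc] using h
  | ready r =>
    left; by_cases hc : s.readyFrom src = none <;> simpa [serverHandler, hc] using h
  | requestChunk => exact .inl h
  | returnChunk r c p => exact .inl h

theorem serverHandler_gotFrom {j : Fin N} {r : Digest}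
    (h : (serverHandler P me x src s m).1.gotFrom j = some r) :
    s.gotFrom j = some r ∨ j = src ∧ m = .gotChunk r := by
  cases m with
  | chunk r c p =>
    left; simp only [serverHandler] at h; split_ifs at h <;> exact h
  | gotChunk r' =>
    by_cases hc : s.gotFrom src = none
    · simp only [serverHandler, if_pos hc] at h
      by_cases hj : j = src
      · subst hj; simp only [Function.update_self, Option.some.injEq] at h
        right; exact ⟨rfl, by rw [h]⟩
      · left; simpa [hj] using h
    · left; simpa [serverHandler, hc] using h
  | ready r =>
    left; by_cases hc : s.readyFrom src = none <;> simpa [serverHandler, hc] using h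
  | requestChunk => exact .inl h
  | returnChunk r c p => exact .inl h

theorem serverHandler_readyFrom {j : Fin N} {r : Digest}
    (h : (serverHandler P me x src s m).1.readyFrom j = some r) :
    s.readyFrom j = some r ∨ j = src ∧ m = .ready r := by
  cases m with
  | chunk r c p =>
    left; simp only [serverHandler] at h; split_ifs at h <;> exact h
  | ready r' =>
    by_cases hc : s.readyFrom src = none
    · simp only [serverHandler, if_pos hc] at h
      by_cases hj : j = src
      · subst hj; simp only [Function.update_self, Option.some.injEq] at h
        right; exact ⟨rfl, by rw [h]⟩
      · left; simpa [hj] using h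
    · left; simpa [serverHandler, hc] using h
  | gotChunk r =>
    left; by_cases hc : s.gotFrom src = none <;> simpa [serverHandler, hc] using h
  | requestChunk => exact .inl h
  | returnChunk r c p => exact .inl h

theorem serverHandler_requests {k : Fin N}
    (h : k ∈ (serverHandler P me x src s m).1.requests) :
    k ∈ s.requests ∨ k = src ∧ m = .requestChunk := by
  cases m with
  | chunk r c p =>
    left; simp only [serverHandler] at h; split_ifs at h <;> exact h
  | gotChunk r =>
    left; by_cases hc : s.gotFrom src = none <;> simpa [serverHandler, hc] using h
  | ready r =>
    left; by_cases hc : s.readyFrom src = none <;> simpa [serverHandler, hc] using h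
  | requestChunk =>
    simp only [serverHandler, Finset.mem_insert] at h
    exact h.symm.imp id fun h => ⟨h, rfl⟩
  | returnChunk r c p => exact .inl h

/-- Writing another root into a slot can only lose a vote for `r`, so a count for `r` rises only
through a message carrying `r`. -/
theorem card_filter_update_le {g : Fin N → Option Digest} {w r : Digest} (h : w ≠ r) :
    (Finset.univ.filter fun j => Function.update g src (some w) j = some r).card ≤
      (Finset.univ.filter fun j => g j = some r).card := by
  refine Finset.card_le_card fun j hj => ?_
  simp only [Finset.mem_filter, Finset.mem_univ, true_and] at hj ⊢
  by_cases hs : j = src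
  · subst hs; simp [h] at hj
  · simpa [hs] using hj

theorem serverHandler_shareCount {r : Digest}
    (h : N - f ≤ (serverHandler P me x src s m).1.shareCount r) :
    N - f ≤ s.shareCount r ∨ (serverHandler P me x src s m).2 = toAll (.ready r) := by
  cases m with
  | chunk r c p =>
    left; simp only [serverHandler] at h; split_ifs at h <;> exact h
  | gotChunk r' =>
    by_cases hc : s.gotFrom src = none
    · simp only [serverHandler, if_pos hc] at h ⊢
      by_cases hr : r' = r
      · subst hr; right; rw [if_pos h]
      · left; exact h.trans (card_filter_update_le hr)
    · left; simpa [serverHandler, hc] using h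
  | ready r =>
    left; by_cases hc : s.readyFrom src = none
    · simp only [serverHandler, if_pos hc] at h; exact h
    · simpa [serverHandler, hc] using h
  | requestChunk => exact .inl h
  | returnChunk r c p => exact .inl h

/-- If the bound `n` is newly reached, the message handled is a `Ready(r)` and the handler's own
tests apply. Leaving `n` free covers both thresholds, `f + 1` and `2f + 1`. -/
theorem serverHandler_readyCount {r : Digest} {n : ℕ}
    (h : n ≤ (serverHandler P me x src s m).1.readyCount r) :
    n ≤ s.readyCount r ∨
      (f + 1 ≤ n → (serverHandler P me x src s m).2 = toAll (.ready r)) ∧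
      (2 * f + 1 ≤ n → (serverHandler P me x src s m).1.chunkRoot = some r) := by
  cases m with
  | chunk r c p =>
    left; simp only [serverHandler] at h; split_ifs at h <;> exact h
  | gotChunk r =>
    left; by_cases hc : s.gotFrom src = none
    · simp only [serverHandler, if_pos hc] at h; exact h
    · simpa [serverHandler, hc] using h
  | ready r' =>
    by_cases hc : s.readyFrom src = none
    · simp only [serverHandler, if_pos hc] at h ⊢
      by_cases hr : r' = r
      · subst hr; right
        exact ⟨fun h' => if_pos (h'.trans h), fun h' => if_pos (h'.trans h)⟩
      · left; exact h.trans (card_filter_update_le hr)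
    · left; simpa [serverHandler, hc] using h
  | requestChunk => exact .inl h
  | returnChunk r c p => exact .inl h

theorem serverHandler_chunkRoot {r : Digest}
    (h : (serverHandler P me x src s m).1.chunkRoot = some r) :
    s.chunkRoot = some r ∨ 2 * f + 1 ≤ (serverHandler P me x src s m).1.readyCount r := by
  cases m with
  | chunk r c p =>
    left; simp only [serverHandler] at h; split_ifs at h <;> exact h
  | gotChunk r =>
    left; by_cases hc : s.gotFrom src = none <;> simpa [serverHandler, hc] using h
  | ready r' =>
    by_cases hc : s.readyFrom src = none
    · simp only [serverHandler, if_pos hc] at h ⊢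
      split_ifs at h with h'
      · simp only [Option.some.injEq] at h; subst h; exact .inr h'
      · exact .inl h
    · left; simpa [serverHandler, hc] using h
  | requestChunk => exact .inl h
  | returnChunk r c p => exact .inl h

theorem serverHandler_out {k : Fin N} {m' : Msg Chunk Digest}
    (h : (k, m') ∈ (serverHandler P me x src s m).2) :
    (∃ r c p, m' = .gotChunk r ∧ (serverHandler P me x src s m).1.mine = some (r, c, p)) ∨
    ∃ r, m' = .ready r ∧ (N - f ≤ (serverHandler P me x src s m).1.shareCount r ∨
      f + 1 ≤ (serverHandler P me x src s m).1.readyCount r) := by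
  cases m with
  | chunk r c p =>
    simp only [serverHandler] at h ⊢
    split_ifs at h ⊢ with hc
    · exact .inl ⟨r, c, p, h, rfl⟩
    · exact h.elim
  | gotChunk r =>
    by_cases hc : s.gotFrom src = none
    · simp only [serverHandler, if_pos hc] at h ⊢
      split_ifs at h with h'
      · exact .inr ⟨r, h, .inl h'⟩
      · exact h.elim
    · simp [serverHandler, hc] at h
  | ready r =>
    by_cases hc : s.readyFrom src = none
    · simp only [serverHandler, if_pos hc] at h ⊢
      split_ifs at h with h'
      · exact .inr ⟨r, h, .inr h'⟩
      · exact h.elim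
    · simp [serverHandler, hc] at h
  | requestChunk => exact h.elim
  | returnChunk r c p => exact h.elim

end Handler

namespace Execution

variable {P : Params N f Tx Data Chunk Digest} {H : Finset (Fin N)} (R : Execution P H)

/-! ### Servers and the messages sent -/

theorem sent_of_handler {t : ℕ} {src i k : Fin N} {x : Inst N} {m m' : Msg Chunk Digest}
    (hact : R.act t = .recv src i x m)
    (h : (k, m') ∈ (serverHandler P i x src ((R.state t i).server x) m).2 ∪
      (serverHandler P i x src ((R.state t i).server x) m).1.answers) :
    ⟨i, k, x, m'⟩ ∈ (R.cfg (t + 1)).sent := by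
  rw [(R.recv_spec hact).2.2.2.2]
  exact .inr ⟨rfl, rfl, h⟩

/-- A chunk is stored once, after verification and only from the owner of the instance, and the same
step broadcasts `GotChunk`. Authentication turns the receipt into a sent packet when the owner is
correct. -/
theorem mine_spec {t : ℕ} {i : Fin N} {x : Inst N} {r : Digest} {c : Chunk} {p : List Digest}
    (h : ((R.state t i).server x).mine = some (r, c, p)) :
    P.Verify r i c p ∧ (x.2 ∈ H → ⟨x.2, i, x, .chunk r c p⟩ ∈ (R.cfg t).sent) ∧
      ∀ k, ⟨i, k, x, .gotChunk r⟩ ∈ (R.cfg t).sent := by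
  induction t with
  | zero => simp [state_zero, NodeState.initial] at h
  | succ t ih =>
    have hsub := R.sent_subset_succ t
    have lift (h : ((R.state t i).server x).mine = some (r, c, p)) :
        P.Verify r i c p ∧ (x.2 ∈ H → ⟨x.2, i, x, .chunk r c p⟩ ∈ (R.cfg (t + 1)).sent) ∧
          ∀ k, ⟨i, k, x, .gotChunk r⟩ ∈ (R.cfg (t + 1)).sent :=
      ⟨(ih h).1, fun hx => hsub ((ih h).2.1 hx), fun k => hsub ((ih h).2.2 k)⟩
    rcases R.server_succ t i x with hs | ⟨src, m, hact, hi, hs⟩ <;> rw [hs] at h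
    · exact lift h
    · rcases serverHandler_mine h with h | ⟨hm, hsrc, hv, ho⟩
      · exact lift h
      · refine ⟨hv, fun hx => ?_, fun k => R.sent_of_handler hact (.inl ?_)⟩
        · subst hm hsrc
          exact hsub ((R.recv_spec hact).2.1 hx)
        · rw [ho]; rfl

theorem gotFrom_spec {t : ℕ} {i j : Fin N} {x : Inst N} {r : Digest} (hj : j ∈ H)
    (h : ((R.state t i).server x).gotFrom j = some r) :
    ⟨j, i, x, .gotChunk r⟩ ∈ (R.cfg t).sent := by
  induction t with
  | zero => simp [state_zero, NodeState.initial] at h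
  | succ t ih =>
    refine R.sent_subset_succ t ?_
    rcases R.server_succ t i x with hs | ⟨src, m, hact, hi, hs⟩ <;> rw [hs] at h
    · exact ih h
    · rcases serverHandler_gotFrom h with h | ⟨rfl, rfl⟩
      · exact ih h
      · exact (R.recv_spec hact).2.1 hj

theorem readyFrom_spec {t : ℕ} {i j : Fin N} {x : Inst N} {r : Digest} (hj : j ∈ H)
    (h : ((R.state t i).server x).readyFrom j = some r) :
    ⟨j, i, x, .ready r⟩ ∈ (R.cfg t).sent := by
  induction t with
  | zero => simp [state_zero, NodeState.initial] at h
  | succ t ih =>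
    refine R.sent_subset_succ t ?_
    rcases R.server_succ t i x with hs | ⟨src, m, hact, hi, hs⟩ <;> rw [hs] at h
    · exact ih h
    · rcases serverHandler_readyFrom h with h | ⟨rfl, rfl⟩
      · exact ih h
      · exact (R.recv_spec hact).2.1 hj

theorem requests_spec {t : ℕ} {i k : Fin N} {x : Inst N} (hk : k ∈ H)
    (h : k ∈ ((R.state t i).server x).requests) :
    ⟨k, i, x, .requestChunk⟩ ∈ (R.cfg t).sent := by
  induction t with
  | zero => simp [state_zero, NodeState.initial] at h
  | succ t ih =>
    refine R.sent_subset_succ t ?_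
    rcases R.server_succ t i x with hs | ⟨src, m, hact, hi, hs⟩ <;> rw [hs] at h
    · exact ih h
    · rcases serverHandler_requests h with h | ⟨rfl, rfl⟩
      · exact ih h
      · exact (R.recv_spec hact).2.1 hk

/-- The message that lifts the count to the threshold triggers the broadcast in the same step. The
bound on `N` makes the threshold positive, so that it does not hold initially. -/
theorem ready_sent_of_shareCount (hN : 3 * f + 1 ≤ N) {t : ℕ} {i : Fin N} {x : Inst N} {r : Digest}
    (h : N - f ≤ ((R.state t i).server x).shareCount r) (k : Fin N) :
    ⟨i, k, x, .ready r⟩ ∈ (R.cfg t).sent := by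
  induction t with
  | zero =>
    simp [state_zero, NodeState.initial, ServerState.shareCount] at h
    omega
  | succ t ih =>
    rcases R.server_succ t i x with hs | ⟨src, m, hact, hi, hs⟩ <;> rw [hs] at h
    · exact R.sent_subset_succ t (ih h)
    · rcases serverHandler_shareCount h with h | h
      · exact R.sent_subset_succ t (ih h)
      · exact R.sent_of_handler hact (.inl (by rw [h]; rfl))

theorem ready_sent_of_readyCount {t : ℕ} {i : Fin N} {x : Inst N} {r : Digest}
    (h : f + 1 ≤ ((R.state t i).server x).readyCount r) (k : Fin N) :
    ⟨i, k, x, .ready r⟩ ∈ (R.cfg t).sent := by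
  induction t with
  | zero => simp [state_zero, NodeState.initial, ServerState.readyCount] at h
  | succ t ih =>
    rcases R.server_succ t i x with hs | ⟨src, m, hact, hi, hs⟩ <;> rw [hs] at h
    · exact R.sent_subset_succ t (ih h)
    · rcases serverHandler_readyCount h with h | h
      · exact R.sent_subset_succ t (ih h)
      · exact R.sent_of_handler hact (.inl (by rw [h.1 le_rfl]; rfl))

theorem completed_of_readyCount {t : ℕ} {i : Fin N} {x : Inst N} {r : Digest}
    (h : 2 * f + 1 ≤ ((R.state t i).server x).readyCount r) : (R.state t i).Completed x := by
  induction t with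
  | zero => simp [state_zero, NodeState.initial, ServerState.readyCount] at h
  | succ t ih =>
    rcases R.server_succ t i x with hs | ⟨src, m, hact, hi, hs⟩
    · rw [hs] at h
      exact (R.extends_of_le t.le_succ i).completed (ih h)
    · rw [hs] at h
      rcases serverHandler_readyCount h with h | h
      · exact (R.extends_of_le t.le_succ i).completed (ih h)
      · rw [NodeState.Completed, hs, h.2 le_rfl]; simp

/-- A root is written only when its count has reached `2f + 1`, and counts never fall. An
overwritten root causes no difficulty, because only the current value is concerned. -/
theorem readyCount_of_chunkRoot {t : ℕ} {i : Fin N} {x : Inst N} {r : Digest}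
    (h : ((R.state t i).server x).chunkRoot = some r) :
    2 * f + 1 ≤ ((R.state t i).server x).readyCount r := by
  induction t with
  | zero => simp [state_zero, NodeState.initial] at h
  | succ t ih =>
    have hmono := (R.extends_of_le t.le_succ i).readyCount x r
    rcases R.server_succ t i x with hs | ⟨src, m, hact, hi, hs⟩
    · rw [hs] at h
      exact (ih h).trans hmono
    · rw [hs] at h
      rcases serverHandler_chunkRoot h with h | h
      · exact (ih h).trans hmono
      · rwa [hs]

theorem answers_sent {t : ℕ} {i k : Fin N} {x : Inst N} {m : Msg Chunk Digest}
    (h : (k, m) ∈ ((R.state t i).server x).answers) : ⟨i, k, x, m⟩ ∈ (R.cfg t).sent := by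
  induction t with
  | zero => simp [state_zero, NodeState.initial, ServerState.answers] at h
  | succ t ih =>
    rcases R.server_succ t i x with hs | ⟨src, m, hact, hi, hs⟩ <;> rw [hs] at h
    · exact R.sent_subset_succ t (ih h)
    · exact R.sent_of_handler hact (.inr h)

/-! ### What a sent message reveals about its sender -/

theorem gotChunk_sent {t : ℕ} {i k : Fin N} {x : Inst N} {r : Digest}
    (h : ⟨i, k, x, .gotChunk r⟩ ∈ (R.cfg t).sent) :
    ∃ c p, ((R.state t i).server x).mine = some (r, c, p) := by
  induction t with
  | zero => simp [sent_zero] at h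
  | succ t ih =>
    rcases R.sent_succ t _ h with h | ⟨src, m, hact, h | h⟩ | ⟨B, -, -, h⟩ | ⟨h, -⟩
    · obtain ⟨c, p, h⟩ := ih h
      exact ⟨c, p, (R.extends_of_le t.le_succ i).mine _ _ h⟩
    · rcases serverHandler_out h with ⟨r', c, p, hr, h⟩ | ⟨r', hr, -⟩
      · cases hr
        exact ⟨c, p, by rw [(R.recv_spec hact).2.2.1]; exact h⟩
      · cases hr
    · obtain ⟨-, r, c, p, -, -, h⟩ := h
      cases h
    · cases h
    · cases h

/-- The recorded request is part of the conclusion so that an answer can be traced back to an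
invocation that preceded it. -/
theorem returnChunk_sent {t : ℕ} {i k : Fin N} {x : Inst N} {r : Digest} {c : Chunk}
    {p : List Digest} (h : ⟨i, k, x, .returnChunk r c p⟩ ∈ (R.cfg t).sent) :
    ((R.state t i).server x).mine = some (r, c, p) ∧
      k ∈ ((R.state t i).server x).requests := by
  induction t with
  | zero => simp [sent_zero] at h
  | succ t ih =>
    rcases R.sent_succ t _ h with h | ⟨src, m, hact, h | h⟩ | ⟨B, -, -, h⟩ | ⟨h, -⟩
    · have := R.extends_of_le t.le_succ i
      exact ⟨this.mine _ _ (ih h).1, this.requests _ (ih h).2⟩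
    · rcases serverHandler_out h with ⟨r', c, p, hr, h⟩ | ⟨r', hr, -⟩ <;> cases hr
    · obtain ⟨hk, r, c, p, hm, -, h⟩ := h
      cases h
      rw [(R.recv_spec hact).2.2.1]
      exact ⟨hm, hk⟩
    · cases h
    · cases h

/-- Amplification creates no new roots: a `Ready(r)` caused by `f + 1` others has a correct sender
among these, whose `Ready(r)` was sent earlier. Induction on time ends at a `Ready(r)` caused by
`GotChunk` votes. The sender varies in the induction. -/
theorem ready_sent (hH : N ≤ H.card + f) {t : ℕ} {i k : Fin N} {x : Inst N} {r : Digest}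
    (h : ⟨i, k, x, .ready r⟩ ∈ (R.cfg t).sent) :
    ∃ j, N - f ≤ ((R.state t j).server x).shareCount r := by
  induction t generalizing i k with
  | zero => simp [sent_zero] at h
  | succ t ih =>
    have lift : (∃ j, N - f ≤ ((R.state t j).server x).shareCount r) →
        ∃ j, N - f ≤ ((R.state (t + 1) j).server x).shareCount r := fun ⟨j, hj⟩ =>
      ⟨j, hj.trans ((R.extends_of_le t.le_succ j).shareCount x r)⟩
    rcases R.sent_succ t _ h with h | ⟨src, m, hact, h | h⟩ | ⟨B, -, -, h⟩ | ⟨h, -⟩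
    · exact lift (ih h)
    · rcases serverHandler_out h with ⟨r', c, p, hr, h⟩ | ⟨r', hr, h | h⟩
      · cases hr
      · cases hr
        exact ⟨i, by rw [(R.recv_spec hact).2.2.1]; exact h⟩
      · cases hr
        -- The count is taken after the current message, so the correct voter is either already
        -- recorded or the sender of that message.
        obtain ⟨j, hj, hjH⟩ := exists_mem_of_lt_card hH h
        simp only [Finset.mem_filter, Finset.mem_univ, true_and] at hj
        rcases serverHandler_readyFrom hj with hj | ⟨rfl, rfl⟩
        · exact lift (ih (R.readyFrom_spec hjH hj))
        · exact lift (ih ((R.recv_spec hact).2.1 hjH))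
    · obtain ⟨-, r, c, p, -, -, h⟩ := h
      cases h
    · cases h
    · cases h

/-- The threshold that caused one `Ready` packet causes the packets to all other nodes too. -/
theorem ready_sent_toAll (hN : 3 * f + 1 ≤ N) {t : ℕ} {i k : Fin N} {x : Inst N} {r : Digest}
    (h : ⟨i, k, x, .ready r⟩ ∈ (R.cfg t).sent) (l : Fin N) :
    ⟨i, l, x, .ready r⟩ ∈ (R.cfg t).sent := by
  induction t with
  | zero => simp [sent_zero] at h
  | succ t ih =>
    rcases R.sent_succ t _ h with h | ⟨src, m, hact, h | h⟩ | ⟨B, -, -, h⟩ | ⟨h, -⟩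
    · exact R.sent_subset_succ t (ih h)
    · have hs := (R.recv_spec hact).2.2.1
      rcases serverHandler_out h with ⟨r', c, p, hr, h⟩ | ⟨r', hr, h | h⟩ <;> cases hr <;>
        rw [← hs] at h
      · exact R.ready_sent_of_shareCount hN h l
      · exact R.ready_sent_of_readyCount h l
    · obtain ⟨-, r, c, p, -, -, h⟩ := h
      cases h
    · cases h
    · cases h

theorem requestChunk_sent {t : ℕ} {i k : Fin N} {x : Inst N}
    (h : ⟨i, k, x, .requestChunk⟩ ∈ (R.cfg t).sent) : ((R.state t i).client x).invoked := by
  induction t with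
  | zero => simp [sent_zero] at h
  | succ t ih =>
    rcases R.sent_succ t _ h with h | ⟨src, m, hact, h | h⟩ | ⟨B, -, -, h⟩ | ⟨h, h'⟩
    · exact (R.extends_of_le t.le_succ i).invoked _ (ih h)
    · rcases serverHandler_out h with ⟨r', c, p, hr, h⟩ | ⟨r', hr, -⟩ <;> cases hr
    · obtain ⟨-, r, c, p, -, -, h⟩ := h
      cases h
    · cases h
    · exact h'

theorem chunk_sent {t : ℕ} {i k : Fin N} {x : Inst N} {r : Digest} {c : Chunk} {p : List Digest}
    (h : ⟨i, k, x, .chunk r c p⟩ ∈ (R.cfg t).sent) :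
    x.2 = i ∧ ∃ B, (R.state t i).proposed x.1 = some B ∧
      r = P.merkleRoot (P.code.encode B) ∧ c = P.code.encode B k ∧
      p = P.merkleProof (P.code.encode B) k := by
  induction t with
  | zero => simp [sent_zero] at h
  | succ t ih =>
    rcases R.sent_succ t _ h with h | ⟨src, m, hact, h | h⟩ | ⟨B, hx, hB, h⟩ | ⟨h, h'⟩
    · obtain ⟨hx, B, hB, h⟩ := ih h
      exact ⟨hx, B, (R.extends_of_le t.le_succ i).proposed _ _ hB, h⟩
    · rcases serverHandler_out h with ⟨r', c, p, hr, h⟩ | ⟨r', hr, -⟩ <;> cases hr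
    · obtain ⟨-, r, c, p, -, -, h⟩ := h
      cases h
    · simp only [Msg.chunk.injEq] at h
      exact ⟨hx, B, hB, h⟩
    · cases h

/-- A proposed block has been formed from the current observation and sent to all servers. -/
theorem proposed_spec {t : ℕ} {i : Fin N} {e : ℕ} {B : Data}
    (h : (R.state t i).proposed e = some B) :
    (∃ t' T, B = P.format.serialize T (R.state t' i).observation) ∧
      ∀ k, ⟨i, k, (e, i), .chunk (P.merkleRoot (P.code.encode B)) (P.code.encode B k)
        (P.merkleProof (P.code.encode B) k)⟩ ∈ (R.cfg t).sent := by
  induction t with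
  | zero => simp [state_zero, NodeState.initial] at h
  | succ t ih =>
    rcases R.proposed_succ t i e with hs | ⟨T, hs, hsent⟩ <;> rw [hs] at h
    · exact ⟨(ih h).1, fun k => R.sent_subset_succ t ((ih h).2 k)⟩
    · cases h
      exact ⟨⟨t, T, rfl⟩, hsent⟩

theorem invoked_spec {t : ℕ} {i : Fin N} {x : Inst N} (h : ((R.state t i).client x).invoked)
    (k : Fin N) : ⟨i, k, x, .requestChunk⟩ ∈ (R.cfg t).sent := by
  induction t with
  | zero => simp [state_zero, NodeState.initial] at h
  | succ t ih =>
    rcases R.client_succ t i x with hs | ⟨src, m, hact, hi, hs⟩ | ⟨hact, hs⟩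
    · rw [hs] at h; exact R.sent_subset_succ t (ih h)
    · rw [hs] at h
      refine R.sent_subset_succ t (ih ?_)
      cases m <;> try exact h
      simp only [clientHandler] at h
      split_ifs at h <;> exact h
    · have hstep := R.step t
      rw [hact] at hstep
      obtain ⟨-, -, -, hstep⟩ := hstep
      rw [hstep]
      exact .inr ⟨rfl, rfl, rfl⟩

/-! ### Uniqueness of the root in an instance -/

theorem mine_unique {t t' : ℕ} {i : Fin N} {x : Inst N} {v v' : Digest × Chunk × List Digest}
    (h : ((R.state t i).server x).mine = some v) (h' : ((R.state t' i).server x).mine = some v') :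
    v = v' := by
  have h1 := (R.extends_of_le (le_max_left t t') i).mine _ _ h
  have h2 := (R.extends_of_le (le_max_right t t') i).mine _ _ h'
  rw [h1] at h2
  exact Option.some.inj h2

theorem gotChunk_unique {t t' : ℕ} {i k k' : Fin N} {x : Inst N} {r r' : Digest}
    (h : ⟨i, k, x, .gotChunk r⟩ ∈ (R.cfg t).sent)
    (h' : ⟨i, k', x, .gotChunk r'⟩ ∈ (R.cfg t').sent) : r = r' := by
  obtain ⟨c, p, h⟩ := R.gotChunk_sent h
  obtain ⟨c', p', h'⟩ := R.gotChunk_sent h'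
  exact congrArg Prod.fst (R.mine_unique h h')

/-- All `Ready` messages of correct nodes in an instance carry the same root. -/
theorem ready_unique (hN : 3 * f + 1 ≤ N) (hH : N ≤ H.card + f) {t t' : ℕ} {i i' k k' : Fin N}
    {x : Inst N} {r r' : Digest} (h : ⟨i, k, x, .ready r⟩ ∈ (R.cfg t).sent)
    (h' : ⟨i', k', x, .ready r'⟩ ∈ (R.cfg t').sent) : r = r' := by
  obtain ⟨j, hj⟩ := R.ready_sent hH h
  obtain ⟨j', hj'⟩ := R.ready_sent hH h'
  have hcard := Finset.card_union_add_card_inter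
    (Finset.univ.filter fun l => ((R.state t j).server x).gotFrom l = some r)
    (Finset.univ.filter fun l => ((R.state t' j').server x).gotFrom l = some r')
  have hle := Finset.card_le_univ
    ((Finset.univ.filter fun l => ((R.state t j).server x).gotFrom l = some r) ∪
    (Finset.univ.filter fun l => ((R.state t' j').server x).gotFrom l = some r'))
  rw [Fintype.card_fin] at hle
  rw [ServerState.shareCount] at hj hj'
  -- Two sets of `N - f` voters meet in at least `N - 2f ≥ f + 1` nodes, hence in a correct one.
  obtain ⟨l, hl, hlH⟩ := exists_mem_of_lt_card hH (f := f)
    (A := (Finset.univ.filter fun l => ((R.state t j).server x).gotFrom l = some r) ∩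
    (Finset.univ.filter fun l => ((R.state t' j').server x).gotFrom l = some r')) (by omega)
  simp only [Finset.mem_inter, Finset.mem_filter, Finset.mem_univ, true_and] at hl
  exact R.gotChunk_unique (R.gotFrom_spec hlH hl.1) (R.gotFrom_spec hlH hl.2)

theorem ready_sent_of_chunkRoot {t : ℕ} {i : Fin N} {x : Inst N} {r : Digest}
    (h : ((R.state t i).server x).chunkRoot = some r) (k : Fin N) :
    ⟨i, k, x, .ready r⟩ ∈ (R.cfg t).sent :=
  R.ready_sent_of_readyCount (by have := R.readyCount_of_chunkRoot h; omega) k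

/-! ### Liveness of the dispersal -/

theorem eventually_gotFrom {t : ℕ} {i j : Fin N} {x : Inst N} {r : Digest} (hj : j ∈ H)
    (hi : i ∈ H) (h : ⟨j, i, x, .gotChunk r⟩ ∈ (R.cfg t).sent) :
    ∃ t', ((R.state t' i).server x).gotFrom j = some r := by
  obtain ⟨t', hact⟩ := R.delivery t _ h hi
  refine ⟨t' + 1, ?_⟩
  -- The slot may have been filled by an earlier message. That does not matter, because a correct
  -- `j` sends `GotChunk` for one root only.
  have hne : ((R.state (t' + 1) i).server x).gotFrom j ≠ none := by
    rw [(R.recv_spec hact).2.2.1]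
    by_cases hc : ((R.state t' i).server x).gotFrom j = none <;> simp [serverHandler, hc]
  obtain ⟨r', hr'⟩ := Option.ne_none_iff_exists'.1 hne
  rw [hr', R.gotChunk_unique h (R.gotFrom_spec hj hr')]

theorem eventually_readyFrom (hN : 3 * f + 1 ≤ N) (hH : N ≤ H.card + f) {t : ℕ} {i j : Fin N}
    {x : Inst N} {r : Digest} (hj : j ∈ H)
    (hi : i ∈ H) (h : ⟨j, i, x, .ready r⟩ ∈ (R.cfg t).sent) :
    ∃ t', ((R.state t' i).server x).readyFrom j = some r := by
  obtain ⟨t', hact⟩ := R.delivery t _ h hi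
  refine ⟨t' + 1, ?_⟩
  have hne : ((R.state (t' + 1) i).server x).readyFrom j ≠ none := by
    rw [(R.recv_spec hact).2.2.1]
    by_cases hc : ((R.state t' i).server x).readyFrom j = none <;> simp [serverHandler, hc]
  obtain ⟨r', hr'⟩ := Option.ne_none_iff_exists'.1 hne
  rw [hr', R.ready_unique hN hH h (R.readyFrom_spec hj hr')]

theorem eventually_card_le_shareCount {A : Finset (Fin N)} (hA : A ⊆ H) {i : Fin N} (hi : i ∈ H)
    {x : Inst N} {r : Digest} (h : ∀ j ∈ A, ∃ t, ⟨j, i, x, .gotChunk r⟩ ∈ (R.cfg t).sent) :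
    ∃ t, A.card ≤ ((R.state t i).server x).shareCount r := by
  obtain ⟨t, ht⟩ := exists_forall_mem_of_monotone (s := (A : Set (Fin N))) A.finite_toSet
    (p := fun j t => ((R.state t i).server x).gotFrom j = some r)
    (fun j _ t t' htt h => (R.extends_of_le htt i).gotFrom _ _ _ h)
    (fun j hj => by
      obtain ⟨t, ht⟩ := h j hj
      exact R.eventually_gotFrom (hA hj) hi ht)
  exact ⟨t, Finset.card_le_card fun j hj => by simpa using ht j hj⟩

theorem eventually_card_le_readyCount (hN : 3 * f + 1 ≤ N) (hH : N ≤ H.card + f)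
    {A : Finset (Fin N)} (hA : A ⊆ H) {i : Fin N} (hi : i ∈ H)
    {x : Inst N} {r : Digest} (h : ∀ j ∈ A, ∃ t, ⟨j, i, x, .ready r⟩ ∈ (R.cfg t).sent) :
    ∃ t, A.card ≤ ((R.state t i).server x).readyCount r := by
  obtain ⟨t, ht⟩ := exists_forall_mem_of_monotone (s := (A : Set (Fin N))) A.finite_toSet
    (p := fun j t => ((R.state t i).server x).readyFrom j = some r)
    (fun j _ t t' htt h => (R.extends_of_le htt i).readyFrom _ _ _ h)
    (fun j hj => by
      obtain ⟨t, ht⟩ := h j hj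
      exact R.eventually_readyFrom hN hH (hA hj) hi ht)
  exact ⟨t, Finset.card_le_card fun j hj => by simpa using ht j hj⟩

/-- If all correct nodes send `Ready(r)`, the dispersal completes everywhere with root `r`. -/
theorem eventually_chunkRoot_of_ready (hN : 3 * f + 1 ≤ N) (hH : N ≤ H.card + f)
    {x : Inst N} {r : Digest} (h : ∀ j ∈ H, ∀ k, ∃ t, ⟨j, k, x, .ready r⟩ ∈ (R.cfg t).sent)
    {i : Fin N} (hi : i ∈ H) : ∃ t, ((R.state t i).server x).chunkRoot = some r := by
  obtain ⟨t, ht⟩ := R.eventually_card_le_readyCount hN hH subset_rfl hi (fun j hj => h j hj i)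
  refine ⟨t, ?_⟩
  obtain ⟨r', hr'⟩ := Option.ne_none_iff_exists'.1
    (R.completed_of_readyCount (x := x) (r := r) (i := i) (t := t) (by omega))
  obtain ⟨t', h'⟩ := h i hi i
  rw [hr', R.ready_unique hN hH h' (R.ready_sent_of_chunkRoot hr' i)]

/-- If the dispersal completes at a correct node, it completes at all of them, with the same
root, and `N - 2f` correct nodes hold a chunk under this root. -/
theorem eventually_chunkRoot_of_completed (hN : 3 * f + 1 ≤ N) (hH : N ≤ H.card + f)
    {x : Inst N} {k : Fin N} {t : ℕ} (h : (R.state t k).Completed x) :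
    ∃ r, (∀ i ∈ H, ∃ t, ((R.state t i).server x).chunkRoot = some r) ∧
      ∃ A ⊆ H, N - 2 * f ≤ A.card ∧
        ∀ j ∈ A, ∃ t c p, ((R.state t j).server x).mine = some (r, c, p) := by
  obtain ⟨r, hr⟩ := Option.ne_none_iff_exists'.1 h
  have hcount := R.readyCount_of_chunkRoot hr
  refine ⟨r, fun i hi => R.eventually_chunkRoot_of_ready hN hH (fun j hj l => ?_) hi, ?_⟩
  -- Of the `2f + 1` senders of `Ready(r)` at least `f + 1` are correct. Their messages reach every
  -- correct node, which then sends `Ready(r)` itself.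
  · have hA := card_le_card_inter_add hH
      (Finset.univ.filter fun j => ((R.state t k).server x).readyFrom j = some r)
    rw [ServerState.readyCount] at hcount
    obtain ⟨t', ht'⟩ := R.eventually_card_le_readyCount hN hH Finset.inter_subset_right hj
      (x := x) (r := r)
      (A := (Finset.univ.filter fun j => ((R.state t k).server x).readyFrom j = some r) ∩ H)
      (fun i hi => by
        simp only [Finset.mem_inter, Finset.mem_filter, Finset.mem_univ, true_and] at hi
        exact ⟨t, R.ready_sent_toAll hN (R.readyFrom_spec hi.2 hi.1) j⟩)
    exact ⟨t', R.ready_sent_of_readyCount (by omega) l⟩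
  -- The holders of chunks are the correct ones among the `N - f` voters behind `r`; at least `N -
  -- 2f` of them remain.
  · obtain ⟨j, hj⟩ := R.ready_sent hH (R.ready_sent_of_chunkRoot hr k)
    have hA := card_le_card_inter_add hH
      (Finset.univ.filter fun l => ((R.state t j).server x).gotFrom l = some r)
    rw [ServerState.shareCount] at hj
    refine ⟨(Finset.univ.filter fun l => ((R.state t j).server x).gotFrom l = some r) ∩ H,
      Finset.inter_subset_right, ?_, fun l hl => ?_⟩
    · omega
    · simp only [Finset.mem_inter, Finset.mem_filter, Finset.mem_univ, true_and] at hl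
      exact ⟨t, R.gotChunk_sent (R.gotFrom_spec hl.2 hl.1)⟩

/-- A block proposed by a correct node is eventually dispersed. -/
theorem eventually_completed_of_proposed (hN : 3 * f + 1 ≤ N) (hH : N ≤ H.card + f) {t : ℕ}
    {e : ℕ} {j : Fin N} (hj : j ∈ H) (h : (R.state t j).proposed e ≠ none) {i : Fin N}
    (hi : i ∈ H) : ∃ t, (R.state t i).Completed (e, j) := by
  obtain ⟨B, hB⟩ := Option.ne_none_iff_exists'.1 h
  have hsent := (R.proposed_spec hB).2
  set r := P.merkleRoot (P.code.encode B) with hr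
  have hmine : ∀ k ∈ H, ∃ t c p, ((R.state t k).server (e, j)).mine = some (r, c, p) := by
    intro k hk
    obtain ⟨t', hact⟩ := R.delivery t _ (hsent k) hk
    have hne : ((R.state (t' + 1) k).server (e, j)).mine ≠ none := by
      rw [(R.recv_spec hact).2.2.1]
      by_cases hc : ((R.state t' k).server (e, j)).mine = none
      · simp [serverHandler, hc, r, P.verify_merkleProof]
      · simp [serverHandler, hc]
    obtain ⟨⟨r', c, p⟩, hv⟩ := Option.ne_none_iff_exists'.1 hne
    -- Whatever chunk is stored came from the correct owner `j`, who proposes only one block in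
    -- epoch `e`; hence its root is `r`.
    obtain ⟨-, B', hB', h', -⟩ := R.chunk_sent ((R.mine_spec hv).2.1 hj)
    refine ⟨t' + 1, c, p, ?_⟩
    have h1 := (R.extends_of_le (le_max_left t (t' + 1)) j).proposed _ _ hB
    have h2 := (R.extends_of_le (le_max_right t (t' + 1)) j).proposed _ _ hB'
    rw [h1] at h2
    rw [hv, h', hr, Option.some.inj h2]
  obtain ⟨t', ht'⟩ := R.eventually_chunkRoot_of_ready hN hH (x := (e, j)) (r := r)
    (fun k hk l => by
      obtain ⟨t', ht'⟩ := R.eventually_card_le_shareCount subset_rfl hk (x := (e, j)) (r := r)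
        (fun m hm => by
          obtain ⟨t', c, p, h⟩ := hmine m hm
          exact ⟨t', (R.mine_spec h).2.2 k⟩)
      exact ⟨t', R.ready_sent_of_shareCount hN (by omega) l⟩) hi
  exact ⟨t', by rw [NodeState.Completed, ht']; simp⟩

/-- Each action concerns the server state of at most one instance. -/
theorem finite_completed (t : ℕ) (i : Fin N) : {x | (R.state t i).Completed x}.Finite := by
  induction t with
  | zero => simp [state_zero, NodeState.initial, NodeState.Completed]
  | succ t ih =>
    cases hact : R.act t with
    | recv src dst x m =>
      refine (ih.insert x).subset fun y hy => ?_
      rcases R.server_succ t i y with hs | ⟨src', m', hact', -⟩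
      · right; simpa [NodeState.Completed, hs] using hy
      · rw [hact] at hact'; cases hact'; exact .inl rfl
    | _ =>
      refine ih.subset fun y hy => ?_
      rcases R.server_succ t i y with hs | ⟨src', m', hact', -⟩
      · simpa [NodeState.Completed, hs] using hy
      · rw [hact] at hact'; cases hact'

end Execution

/-! ### The client -/

namespace ClientState

theorem under_eq_some {s : ClientState N Data Chunk Digest} {r : Digest} {j : Fin N} {c : Chunk} :
    s.under r j = some c ↔ s.chunks j = some (r, c) := by
  unfold under
  rcases h : s.chunks j with _ | ⟨r', c'⟩
  · simp
  · by_cases hr : r' = r <;> simp [hr]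

/-- A `Retrieve` is finished if and only if `N - 2f` chunks with the same root are stored. -/
def WellFormed (P : Params N f Tx Data Chunk Digest) (s : ClientState N Data Chunk Digest) :
    Prop :=
  (s.result = none →
    ∀ r, (Finset.univ.filter fun j => s.under r j ≠ none).card < N - 2 * f) ∧
  ∀ v, s.result = some v → ∃ r,
    (Finset.univ.filter fun j => s.under r j ≠ none).card = N - 2 * f ∧
      v = decodeAndCheck P r (s.under r)

theorem card_under_update {s s' : ClientState N Data Chunk Digest} {src : Fin N} {r : Digest}
    {c : Chunk} (h : s.chunks src = none)
    (hs' : s'.chunks = Function.update s.chunks src (some (r, c))) (r' : Digest) :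
    (Finset.univ.filter fun j => s'.under r' j ≠ none).card =
      (Finset.univ.filter fun j => s.under r' j ≠ none).card + if r' = r then 1 else 0 := by
  have hsrc : s.under r' src = none := by simp [under, h]
  have hne (j) (hj : j ≠ src) : s'.under r' j = s.under r' j := by
    simp [under, hs', hj]
  by_cases hr : r' = r
  · subst hr
    have : (Finset.univ.filter fun j => s'.under r' j ≠ none) =
        insert src (Finset.univ.filter fun j => s.under r' j ≠ none) := by
      ext j
      by_cases hj : j = src
      · subst hj; simp [under, hs']
      · simp [hne j hj, hj]
    rw [this, Finset.card_insert_of_notMem (by simp [hsrc]), if_pos rfl]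
  · rw [if_neg hr, add_zero]
    congr 1
    ext j
    by_cases hj : j = src
    · subst hj
      have : s'.under r' j = none := by simp [under, hs', Ne.symm hr]
      simp [hsrc, this]
    · simp [hne j hj]

theorem WellFormed.clientHandler {P : Params N f Tx Data Chunk Digest} {src : Fin N}
    {s : ClientState N Data Chunk Digest} (h : s.WellFormed P) (m : Msg Chunk Digest) :
    (clientHandler P src s m).WellFormed P := by
  cases m with
  | returnChunk r c p =>
    by_cases hc : s.invoked ∧ s.result = none ∧ P.Verify r src c p ∧ s.chunks src = none
    · have hcard := card_under_update hc.2.2.2 (r := r) (c := c)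
        (s' := { s with chunks := Function.update s.chunks src (some (r, c)) }) rfl
      simp only [DispersedLedger.clientHandler, if_pos hc]
      split_ifs with hle
      · refine ⟨fun h' => (Option.some_ne_none _ h').elim, fun v hv => ⟨r, ?_, ?_⟩⟩
        -- Before this message the count was below `N - 2f`, and it grows by one. The equality
        -- matters because `decode_encode` speaks of exactly `N - 2f` chunks.
        · refine le_antisymm ((hcard r).trans_le ?_) hle
          rw [if_pos rfl]
          exact h.1 hc.2.1 r
        · exact (Option.some.inj hv).symm
      · refine ⟨fun _ r' => ?_, fun v hv => ?_⟩
        · by_cases hr : r' = r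
          · subst hr; exact not_le.1 hle
          · rw [hcard r', if_neg hr]; exact h.1 hc.2.1 r'
        · exact absurd hv (by simp [hc.2.1])
    · simpa only [DispersedLedger.clientHandler, if_neg hc] using h
  | _ => exact h

end ClientState

theorem clientHandler_chunks {P : Params N f Tx Data Chunk Digest} {src : Fin N}
    {s : ClientState N Data Chunk Digest} {m : Msg Chunk Digest} {j : Fin N} {r : Digest}
    {c : Chunk} (h : (clientHandler P src s m).chunks j = some (r, c)) :
    s.chunks j = some (r, c) ∨
      j = src ∧ ∃ p, m = .returnChunk r c p ∧ P.Verify r src c p := by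
  cases m with
  | returnChunk r' c' p =>
    by_cases hc : s.invoked ∧ s.result = none ∧ P.Verify r' src c' p ∧ s.chunks src = none
    · have : Function.update s.chunks src (some (r', c')) j = some (r, c) := by
        simp only [clientHandler, if_pos hc] at h
        split_ifs at h <;> exact h
      by_cases hj : j = src
      · subst hj
        simp only [Function.update_self, Option.some.injEq, Prod.mk.injEq] at this
        obtain ⟨rfl, rfl⟩ := this
        exact .inr ⟨rfl, p, rfl, hc.2.2.1⟩
      · left; simpa [hj] using this
    · left; simpa only [clientHandler, if_neg hc] using h
  | _ => exact .inl h

namespace Execution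

variable {P : Params N f Tx Data Chunk Digest} {H : Finset (Fin N)} (R : Execution P H)

theorem client_wellFormed (hN : 3 * f + 1 ≤ N) (t : ℕ) (i : Fin N) (x : Inst N) :
    ((R.state t i).client x).WellFormed P := by
  induction t with
  | zero =>
    refine ⟨fun _ r => ?_, fun v hv => ?_⟩
    · simp [state_zero, NodeState.initial, ClientState.under]
      omega
    · simp [state_zero, NodeState.initial] at hv
  | succ t ih =>
    rcases R.client_succ t i x with hs | ⟨src, m, hact, hi, hs⟩ | ⟨hact, hs⟩ <;> rw [hs]
    · exact ih
    · exact ih.clientHandler m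
    · exact ih

theorem chunks_spec {t : ℕ} {i j : Fin N} {x : Inst N} {r : Digest} {c : Chunk}
    (h : ((R.state t i).client x).chunks j = some (r, c)) :
    ∃ t' p, R.act t' = .recv j i x (.returnChunk r c p) ∧ P.Verify r j c p := by
  induction t with
  | zero => simp [state_zero, NodeState.initial] at h
  | succ t ih =>
    rcases R.client_succ t i x with hs | ⟨src, m, hact, hi, hs⟩ | ⟨hact, hs⟩ <;> rw [hs] at h
    · exact ih h
    · rcases clientHandler_chunks h with h | ⟨rfl, p, rfl, hv⟩
      · exact ih h
      · exact ⟨t, p, hact, hv⟩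
    · exact ih h

theorem mine_of_chunks {t : ℕ} {i j : Fin N} {x : Inst N} {r : Digest} {c : Chunk} (hj : j ∈ H)
    (h : ((R.state t i).client x).chunks j = some (r, c)) :
    ∃ t' p, ((R.state t' j).server x).mine = some (r, c, p) := by
  obtain ⟨t', p, hact, -⟩ := R.chunks_spec h
  exact ⟨t', p, (R.returnChunk_sent ((R.recv_spec hact).2.1 hj)).1⟩

/-- Retrieving an instance of a correct node yields the block which this node has dispersed. -/
theorem result_eq_of_correct (hN : 3 * f + 1 ≤ N) (hH : N ≤ H.card + f)
    (hHash : R.NoHashCollision) {t : ℕ} {i k : Fin N} {e : ℕ} (hk : k ∈ H)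
    {v : Retrieved Data} (h : ((R.state t i).client (e, k)).result = some v) :
    ∃ t' B, (R.state t' k).proposed e = some B ∧ v = .block B := by
  obtain ⟨r, hcard, rfl⟩ := (R.client_wellFormed hN t i (e, k)).2 v h
  set D := Finset.univ.filter fun j => ((R.state t i).client (e, k)).under r j ≠ none with hD
  -- Since `N - 2f ≥ f + 1`, one chunk comes from a correct server, which got it from `k`. This
  -- identifies `r` as the root of the block `B` proposed by `k`.
  obtain ⟨j, hj, hjH⟩ := exists_mem_of_lt_card hH (A := D) (by omega)
  simp only [hD, Finset.mem_filter, Finset.mem_univ, true_and] at hj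
  obtain ⟨c, hc⟩ := Option.ne_none_iff_exists'.1 hj
  obtain ⟨t', p, hm⟩ := R.mine_of_chunks hjH (ClientState.under_eq_some.1 hc)
  obtain ⟨-, B, hB, rfl, -⟩ := R.chunk_sent ((R.mine_spec hm).2.1 hk)
  refine ⟨t', B, hB, ?_⟩
  have hunder : ((R.state t i).client (e, k)).under (P.merkleRoot (P.code.encode B)) =
      fun j => if j ∈ D then some (P.code.encode B j) else none := by
    funext l
    by_cases hl : l ∈ D
    · rw [if_pos hl]
      simp only [hD, Finset.mem_filter, Finset.mem_univ, true_and] at hl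
      obtain ⟨c', hc'⟩ := Option.ne_none_iff_exists'.1 hl
      obtain ⟨t'', p', hact, hv⟩ := R.chunks_spec (ClientState.under_eq_some.1 hc')
      -- Server `l` may be faulty, but its proof was checked against the root of `B`. Without
      -- collisions among the inner nodes its leaf digest is the one in the tree of `B`, and without
      -- collisions among the leaves its chunk is that of `B`.
      have hleaf := eq_leaf_of_pathRoot_eq P.hash.node hHash.2 P.depth
        (P.leaves (P.code.encode B)) l (P.lt_two_pow_depth l) (P.hash.leaf c') p'
        (fun q hq => .inl (.inr ⟨t'', l, i, (e, k), _, c', p', hact, hq⟩))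
        (fun q hq => .inr ⟨t', k, e, B, hk, hB, hq⟩) hv
      rw [Params.leaves_coe] at hleaf
      rw [hc']
      congr 1
      exact hHash.1 (.inl (.inr ⟨t'', l, i, (e, k), _, p', hact⟩))
        (.inr ⟨t', k, e, B, l, hk, hB, rfl⟩) hleaf
    · rw [if_neg hl]
      simpa [hD] using hl
  rw [hunder, decodeAndCheck, P.code.decode_encode B D hcard, if_pos rfl]

/-- Once the dispersal is complete at some node, a `Retrieve` invoked by a correct node
eventually finishes. -/
theorem eventually_hasRetrieved (hN : 3 * f + 1 ≤ N) (hH : N ≤ H.card + f) {x : Inst N}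
    {k : Fin N} {t₀ : ℕ} (hc : (R.state t₀ k).Completed x) {i : Fin N} (hi : i ∈ H) {t₁ : ℕ}
    (hinv : ((R.state t₁ i).client x).invoked) : ∃ t, (R.state t i).HasRetrieved x := by
  obtain ⟨r, hroot, A, hAH, hA, hmine⟩ := R.eventually_chunkRoot_of_completed hN hH hc
  -- A client whose `Retrieve` never finishes goes on accepting chunks, so all holders in `A` get
  -- through to it, and then the count contradicts `WellFormed`.
  by_contra! hno
  have hnone (t) : ((R.state t i).client x).result = none := not_not.1 (hno t)
  have key : ∀ j ∈ (A : Set (Fin N)), ∃ t c, ((R.state t i).client x).chunks j = some (r, c) := by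
    intro j hjA
    have hj : j ∈ H := hAH hjA
    obtain ⟨t₂, c, p, hm⟩ := hmine j hjA
    obtain ⟨t₃, hr⟩ := hroot j hj
    obtain ⟨t₄, hact⟩ := R.delivery t₁ _ (R.invoked_spec hinv j) hj
    have hreq : i ∈ ((R.state (t₄ + 1) j).server x).requests := by
      rw [(R.recv_spec hact).2.2.1]; exact Finset.mem_insert_self _ _
    obtain ⟨T, h2, h3, h4⟩ : ∃ T, t₂ ≤ T ∧ t₃ ≤ T ∧ t₄ + 1 ≤ T :=
      ⟨t₂ + t₃ + t₄ + 1, by omega, by omega, by omega⟩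
    -- Monotonicity only says that a root is still set; its value is recovered from the uniqueness
    -- of `Ready`.
    have hroot' : ((R.state T j).server x).chunkRoot = some r := by
      obtain ⟨r', hr'⟩ := Option.ne_none_iff_exists'.1
        ((R.extends_of_le h3 j).chunkRoot x (by rw [hr]; simp))
      rw [hr', R.ready_unique hN hH (R.ready_sent_of_chunkRoot hr j)
        (R.ready_sent_of_chunkRoot hr' j)]
    have hsent : ⟨j, i, x, .returnChunk r c p⟩ ∈ (R.cfg T).sent :=
      R.answers_sent ⟨(R.extends_of_le h4 j).requests x hreq, r, c, p,
        (R.extends_of_le h2 j).mine _ _ hm, hroot', rfl⟩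
    obtain ⟨t₅, hact'⟩ := R.delivery T _ hsent hi
    have hspec := R.recv_spec hact'
    -- The delivery time is not known to come after `T` or `t₁`. At that time the answer had been
    -- sent, hence a request had been received, hence the retrieval had been invoked.
    have hinv' : ((R.state t₅ i).client x).invoked :=
      R.requestChunk_sent (R.requests_spec hi (R.returnChunk_sent (hspec.2.1 hj)).2)
    have hne : ((R.state (t₅ + 1) i).client x).chunks j ≠ none := by
      by_cases hcj : ((R.state t₅ i).client x).chunks j = none
      · rw [hspec.2.2.2.1]
        simp only [clientHandler,
          if_pos (show _ ∧ _ ∧ _ ∧ _ from ⟨hinv', hnone t₅, (R.mine_spec hm).1, hcj⟩)]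
        split_ifs <;> simp
      · obtain ⟨v, hv⟩ := Option.ne_none_iff_exists'.1 hcj
        rw [(R.extends_of_le t₅.le_succ i).chunks _ _ _ hv]; simp
    obtain ⟨⟨r', c'⟩, hv⟩ := Option.ne_none_iff_exists'.1 hne
    obtain ⟨t₆, p', hm'⟩ := R.mine_of_chunks hj hv
    have := congrArg Prod.fst (R.mine_unique hm hm')
    exact ⟨t₅ + 1, c', by rw [hv]; simp at this ⊢; exact this.symm⟩
  obtain ⟨T, hT⟩ := exists_forall_mem_of_monotone A.finite_toSet
    (fun j _ t t' htt ⟨c, h⟩ => ⟨c, (R.extends_of_le htt i).chunks _ _ _ h⟩) key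
  have hlt := (R.client_wellFormed hN T i x).1 (hnone T) r
  have hle : A.card ≤
      (Finset.univ.filter fun j => ((R.state T i).client x).under r j ≠ none).card := by
    refine Finset.card_le_card fun j hj => ?_
    obtain ⟨c, hc⟩ := hT j hj
    simp [ClientState.under_eq_some.2 hc]
  omega

/-! ### The dispersal phase -/

/-- The guards of the two input actions persist. Through validity of BA they turn an output into a
completed dispersal or into `N - f` outputs `1` at a correct node. -/
theorem baIn_spec {t : ℕ} {i : Fin N} {x : Inst N} {b : Bool}
    (h : (R.state t i).baIn x = some b) :
    (b = true → (R.state t i).Completed x) ∧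
      (b = false → N - f ≤ ((R.state t i).selected x.1).card) := by
  induction t with
  | zero => simp [state_zero, NodeState.initial] at h
  | succ t ih =>
    have hext := R.extends_of_le t.le_succ i
    rcases R.baIn_succ t i x with hs | ⟨hs, hc⟩ | ⟨hs, hc⟩ <;> rw [hs] at h
    · exact ⟨fun hb => hext.completed ((ih h).1 hb),
        fun hb => ((ih h).2 hb).trans (hext.selected_card _)⟩
    · cases h
      exact ⟨fun _ => hext.completed hc, fun hb => by cases hb⟩
    · cases h
      exact ⟨fun hb => (by cases hb), fun _ => hc.trans (hext.selected_card _)⟩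

/-- A node which has left an epoch has proposed a block and obtained all outputs there. -/
theorem passed_spec {t : ℕ} {i : Fin N} {e : ℕ} (he : 1 ≤ e) (h : e < (R.state t i).epoch) :
    (R.state t i).proposed e ≠ none ∧ ∀ j, (R.state t i).baOut (e, j) ≠ none := by
  induction t with
  | zero => simp [state_zero, NodeState.initial] at h; omega
  | succ t ih =>
    have hext := R.extends_of_le t.le_succ i
    suffices (R.state t i).proposed e ≠ none ∧ ∀ j, (R.state t i).baOut (e, j) ≠ none from
      ⟨hext.proposed_ne this.1, fun j => hext.baOut_ne (this.2 j)⟩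
    rcases R.epoch_succ t i with hs | ⟨hs, hp, hb⟩ <;> rw [hs] at h
    · exact ih h
    · rcases (Nat.lt_succ_iff.1 h).eq_or_lt with rfl | h
      · exact ⟨hp, hb⟩
      · exact ih h

theorem eventually_proposed {t : ℕ} {i : Fin N} (hi : i ∈ H) {e : ℕ} (he : 1 ≤ e)
    (h : e ≤ (R.state t i).epoch) : ∃ t' ≥ t, (R.state t' i).proposed e ≠ none := by
  have hep (t') (ht' : t' ≥ t) (hp : ¬ (R.state t' i).proposed e ≠ none) :
      (R.state t' i).epoch = e := by
    by_contra hne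
    have := (R.extends_of_le ht' i).epoch
    exact hp (R.passed_spec he (by omega)).1
  refine R.eventually_of_fair (a := .disperse i) trivial t (fun t' ht' hp => ?_) ?_
  · have := hep t' ht' hp
    exact ⟨_, hi, not_not.1 (by rwa [← this] at hp), [], rfl⟩
  · intro t' ht' hact
    by_cases hp : (R.state t' i).proposed e ≠ none
    · exact (R.extends_of_le t'.le_succ i).proposed_ne hp
    · have hep' := hep t' ht' hp
      have hs := R.step t'
      rw [hact] at hs
      obtain ⟨-, -, T, hs⟩ := hs
      simp only [state] at hep' ⊢
      rw [hs]
      simp [Config.update, hep']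

/-- Fairness applies only as long as the node is in epoch `e`; leaving it disables the action, hence
the second alternative. -/
theorem eventually_inputOne {t : ℕ} {i : Fin N} (hi : i ∈ H) {e : ℕ} {j : Fin N}
    (h : e ≤ (R.state t i).epoch) (hp : (R.state t i).proposed e ≠ none)
    (hc : (R.state t i).Completed (e, j)) :
    ∃ t' ≥ t, (R.state t' i).baIn (e, j) ≠ none ∨ e < (R.state t' i).epoch := by
  refine R.eventually_of_fair (a := .inputOne i (e, j)) trivial t (fun t' ht' hn => ?_) ?_
  · push Not at hn
    have hext := R.extends_of_le ht' i
    have hep : e = (R.state t' i).epoch := le_antisymm (h.trans hext.epoch) hn.2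
    exact ⟨_, hi, hep, hep ▸ hext.proposed_ne hp, hext.completed hc, hn.1, rfl⟩
  · intro t' ht' hact
    left
    have hs := R.step t'
    rw [hact] at hs
    obtain ⟨-, -, -, -, -, hs⟩ := hs
    simp only [state]
    rw [hs]
    simp [Config.setNode]

theorem eventually_inputZero {t : ℕ} {i : Fin N} (hi : i ∈ H) {e : ℕ}
    (h : e ≤ (R.state t i).epoch) (hp : (R.state t i).proposed e ≠ none)
    (hc : N - f ≤ ((R.state t i).selected e).card) :
    ∃ t' ≥ t, (∀ j, (R.state t' i).baIn (e, j) ≠ none) ∨ e < (R.state t' i).epoch := by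
  refine R.eventually_of_fair (a := .inputZero i) trivial t (fun t' ht' hn => ?_) ?_
  · push Not at hn
    have hext := R.extends_of_le ht' i
    have hep : e = (R.state t' i).epoch := le_antisymm (h.trans hext.epoch) hn.2
    exact ⟨_, hi, hep ▸ hext.proposed_ne hp, hep ▸ hc.trans (hext.selected_card e),
      hep ▸ hn.1, rfl⟩
  · intro t' ht' hact
    by_cases hlt : e < (R.state t' i).epoch
    · exact .inr (hlt.trans_le (R.extends_of_le t'.le_succ i).epoch)
    · left
      have hep : e = (R.state t' i).epoch :=
        le_antisymm (h.trans (R.extends_of_le ht' i).epoch) (not_lt.1 hlt)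
      have hs := R.step t'
      rw [hact] at hs
      obtain ⟨-, -, -, -, hs⟩ := hs
      intro j
      simp only [state] at hep ⊢
      rw [hs]
      by_cases hb : ((R.cfg t').node i).baIn (e, j) = none <;> simp [Config.setNode, hb, ← hep]

/-! ### Outputs of binary agreement in an epoch -/

theorem eventually_selected_of_mem (hBA : ∀ x, R.IsBinaryAgreement x)
    {t : ℕ} {k i : Fin N} (hk : k ∈ H) (hi : i ∈ H) {e : ℕ}
    {A : Finset (Fin N)} (hA : A ⊆ (R.state t k).selected e) :
    ∃ t', A ⊆ (R.state t' i).selected e := by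
  obtain ⟨t', ht'⟩ := exists_forall_mem_of_monotone (s := (A : Set (Fin N))) A.finite_toSet
    (p := fun j t => (R.state t i).baOut (e, j) = some true)
    (fun j _ t t' htt h => (R.extends_of_le htt i).baOut _ _ h)
    (fun j hj => (hBA (e, j)).agreement true k hk t (by
      simpa [NodeState.selected] using hA hj) i hi)
  exact ⟨t', fun j hj => by simpa [NodeState.selected] using ht' j hj⟩

theorem eventually_all_baOut (hBA : ∀ x, R.IsBinaryAgreement x)
    {t : ℕ} {k i : Fin N} (hk : k ∈ H) (hi : i ∈ H) {e : ℕ}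
    (h : ∀ j, (R.state t k).baOut (e, j) ≠ none) :
    ∃ t', ∀ j, (R.state t' i).baOut (e, j) ≠ none := by
  obtain ⟨t', ht'⟩ := exists_forall_mem_of_monotone (s := (Set.univ : Set (Fin N)))
    Set.finite_univ (p := fun j t => (R.state t i).baOut (e, j) ≠ none)
    (fun j _ t t' htt h => (R.extends_of_le htt i).baOut_ne h)
    (fun j _ => by
      obtain ⟨b, hb⟩ := Option.ne_none_iff_exists'.1 (h j)
      obtain ⟨t', ht'⟩ := (hBA (e, j)).agreement b k hk t hb i hi
      exact ⟨t', by rw [ht']; simp⟩)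
  exact ⟨t', fun j => ht' j trivial⟩

/-- If all correct nodes reach epoch `e`, some correct node sees `N - f` outputs `1` there. -/
theorem exists_card_selected (hBA : ∀ x, R.IsBinaryAgreement x)
    (hN : 3 * f + 1 ≤ N) (hH : N ≤ H.card + f) {e : ℕ} (he : 1 ≤ e)
    (hreach : ∀ i ∈ H, ∃ t, e ≤ (R.state t i).epoch) :
    ∃ k ∈ H, ∃ t, N - f ≤ ((R.state t k).selected e).card := by
  by_contra! hno
  -- An output `0` would require an input `0` at a correct node, which is invoked only after `N - f`
  -- outputs `1`.
  have htrue : ∀ k ∈ H, ∀ t j, (R.state t k).baOut (e, j) ≠ none →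
      j ∈ (R.state t k).selected e := by
    intro k hk t j h
    obtain ⟨b, hb⟩ := Option.ne_none_iff_exists'.1 h
    cases b with
    | true => simpa [NodeState.selected] using hb
    | false =>
      obtain ⟨l, hl, hin⟩ := (hBA (e, j)).validity false k hk t hb
      exact absurd ((R.baIn_spec hin).2 rfl) (not_le.2 (hno l hl t))
  -- Leaving the epoch takes all `N` outputs, which are all `1`, contrary to the assumption.
  have hstay : ∀ k ∈ H, ∀ t, ¬ e < (R.state t k).epoch := by
    intro k hk t h
    have hsub : Finset.univ ⊆ (R.state t k).selected e := fun j _ =>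
      htrue k hk t j ((R.passed_spec he h).2 j)
    have := Finset.card_le_card hsub
    rw [Finset.card_univ, Fintype.card_fin] at this
    have := hno k hk t
    omega
  have hprop : ∀ k ∈ H, ∃ t, e ≤ (R.state t k).epoch ∧ (R.state t k).proposed e ≠ none := by
    intro k hk
    obtain ⟨t, ht⟩ := hreach k hk
    obtain ⟨t', htt, ht'⟩ := R.eventually_proposed hk he ht
    exact ⟨t', ht.trans (R.extends_of_le htt k).epoch, ht'⟩
  have hin : ∀ j ∈ H, ∀ k ∈ H, ∃ t, (R.state t k).baIn (e, j) ≠ none := by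
    intro j hj k hk
    obtain ⟨t, -, hp⟩ := hprop j hj
    obtain ⟨t₁, ht₁⟩ := R.eventually_completed_of_proposed hN hH hj hp hk
    obtain ⟨t₂, hep, hp₂⟩ := hprop k hk
    have h1 := R.extends_of_le (le_max_left t₁ t₂) k
    have h2 := R.extends_of_le (le_max_right t₁ t₂) k
    obtain ⟨t', -, h | h⟩ := R.eventually_inputOne hk (hep.trans h2.epoch) (h2.proposed_ne hp₂)
      (h1.completed ht₁)
    · exact ⟨t', h⟩
    · exact absurd h (hstay k hk t')
  obtain ⟨k, hk⟩ : H.Nonempty := by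
    rw [← Finset.card_pos]; omega
  obtain ⟨T, hT⟩ := exists_forall_mem_of_monotone (s := (H : Set (Fin N))) H.finite_toSet
    (p := fun j t => (R.state t k).baOut (e, j) ≠ none)
    (fun j _ t t' htt h => (R.extends_of_le htt k).baOut_ne h)
    (fun j hj => (hBA (e, j)).termination (hin j hj) k hk)
  have := Finset.card_le_card (fun j hj => htrue k hk T j (hT j hj) :
    H ⊆ (R.state T k).selected e)
  have := hno k hk T
  omega

theorem eventually_card_selected (hBA : ∀ x, R.IsBinaryAgreement x)
    (hN : 3 * f + 1 ≤ N) (hH : N ≤ H.card + f) {e : ℕ}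
    (he : 1 ≤ e) (hreach : ∀ i ∈ H, ∃ t, e ≤ (R.state t i).epoch) {i : Fin N} (hi : i ∈ H) :
    ∃ t, N - f ≤ ((R.state t i).selected e).card := by
  obtain ⟨k, hk, t, ht⟩ := R.exists_card_selected hBA hN hH he hreach
  obtain ⟨t', ht'⟩ := R.eventually_selected_of_mem hBA hk hi (subset_refl _)
  exact ⟨t', ht.trans (Finset.card_le_card ht')⟩

theorem eventually_baOut (hBA : ∀ x, R.IsBinaryAgreement x)
    (hN : 3 * f + 1 ≤ N) (hH : N ≤ H.card + f) {e : ℕ}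
    (he : 1 ≤ e) (hreach : ∀ i ∈ H, ∃ t, e ≤ (R.state t i).epoch) {i : Fin N} (hi : i ∈ H) :
    ∃ t, ∀ j, (R.state t i).baOut (e, j) ≠ none := by
  -- If some correct node has left the epoch, agreement alone suffices. Otherwise all correct nodes
  -- stay, so fairness makes each of them fill its missing inputs and termination applies.
  by_cases hpass : ∃ k ∈ H, ∃ t, e < (R.state t k).epoch
  · obtain ⟨k, hk, t, ht⟩ := hpass
    exact R.eventually_all_baOut hBA hk hi (R.passed_spec he ht).2
  push Not at hpass
  have hin : ∀ k ∈ H, ∃ t, ∀ j, (R.state t k).baIn (e, j) ≠ none := by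
    intro k hk
    obtain ⟨t, ht⟩ := hreach k hk
    obtain ⟨t₁, htt, ht₁⟩ := R.eventually_proposed hk he ht
    obtain ⟨t₂, ht₂⟩ := R.eventually_card_selected hBA hN hH he hreach hk
    have h0 := R.extends_of_le htt k
    have h1 := R.extends_of_le (le_max_left t₁ t₂) k
    have h2 := R.extends_of_le (le_max_right t₁ t₂) k
    obtain ⟨t', -, h | h⟩ := R.eventually_inputZero hk ((ht.trans h0.epoch).trans h1.epoch)
      (h1.proposed_ne ht₁) (ht₂.trans (h2.selected_card e))
    · exact ⟨t', h⟩
    · exact absurd h (not_lt.2 (hpass k hk t'))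
  obtain ⟨T, hT⟩ := exists_forall_mem_of_monotone (s := (Set.univ : Set (Fin N)))
    Set.finite_univ (p := fun j t => (R.state t i).baOut (e, j) ≠ none)
    (fun j _ t t' htt h => (R.extends_of_le htt i).baOut_ne h)
    (fun j _ => (hBA (e, j)).termination (fun k hk => (hin k hk).imp fun t h => h j) i hi)
  exact ⟨T, fun j => hT j trivial⟩

/-- Correct nodes reach every epoch. -/
theorem eventually_epoch (hBA : ∀ x, R.IsBinaryAgreement x)
    (hN : 3 * f + 1 ≤ N) (hH : N ≤ H.card + f) {e : ℕ} :
    ∀ i ∈ H, ∃ t, e ≤ (R.state t i).epoch := by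
  induction e with
  | zero => exact fun i _ => ⟨0, Nat.zero_le _⟩
  | succ e ih =>
    intro i hi
    rcases Nat.eq_zero_or_pos e with rfl | he
    · exact ⟨0, by simp [state_zero, NodeState.initial]⟩
    obtain ⟨t₀, ht₀⟩ := ih i hi
    obtain ⟨t₁, htt, ht₁⟩ := R.eventually_proposed hi he ht₀
    obtain ⟨t₂, ht₂⟩ := R.eventually_baOut hBA hN hH he ih hi
    have h0 := R.extends_of_le htt i
    obtain ⟨t, -, ht⟩ := R.eventually_of_fair (a := .nextEpoch i) trivial (max t₁ t₂)
      (p := fun t => e + 1 ≤ (R.state t i).epoch)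
      (fun t' ht' hn => by
        have h1 := R.extends_of_le ((le_max_left _ _).trans ht') i
        have h2 := R.extends_of_le ((le_max_right _ _).trans ht') i
        have hep : e = (R.state t' i).epoch :=
          le_antisymm ((ht₀.trans h0.epoch).trans h1.epoch) (by omega)
        exact ⟨_, hi, hep ▸ h1.proposed_ne ht₁, fun j => hep ▸ h2.baOut_ne (ht₂ j), rfl⟩)
      (fun t' ht' hact => by
        have h1 := R.extends_of_le ((le_max_left _ _).trans ht') i
        have hle : e ≤ (R.state t' i).epoch := (ht₀.trans h0.epoch).trans h1.epoch
        have hs := R.step t'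
        rw [hact] at hs
        obtain ⟨-, -, -, hs⟩ := hs
        simp only [state] at hle ⊢
        rw [hs]
        simpa [Config.setNode] using hle)
    exact ⟨t, ht⟩

/-! ### Estimates -/

/-- The retrieved block is the one proposed by `k`, whose array was the observation of `k` when it
was formed. -/
theorem reported_of_correct (hN : 3 * f + 1 ≤ N) (hH : N ≤ H.card + f)
    (hHash : R.NoHashCollision) {t : ℕ} {i k : Fin N} {e : ℕ} (hk : k ∈ H)
    (h : (R.state t i).HasRetrieved (e, k)) :
    ∃ t', (R.state t i).reported P (e, k) = (R.state t' k).observation := by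
  obtain ⟨v, hv⟩ := Option.ne_none_iff_exists'.1 h
  obtain ⟨t', B, hB, rfl⟩ := R.result_eq_of_correct hN hH hHash hk hv
  obtain ⟨⟨t'', T, rfl⟩, -⟩ := R.proposed_spec hB
  exact ⟨t'', by simp [NodeState.reported, NodeState.content, hv, P.format.parse_serialize]⟩

/-- An estimate does not exceed what some correct node has observed. -/
theorem exists_estimate_le_observation (hN : 3 * f + 1 ≤ N) (hH : N ≤ H.card + f)
    (hHash : R.NoHashCollision) {t : ℕ} {i : Fin N} {e : ℕ}
    (h : ∀ j ∈ (R.state t i).selected e, (R.state t i).HasRetrieved (e, j)) (j : Fin N) :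
    (R.state t i).estimate P e j = 0 ∨
      ∃ k t', (R.state t i).estimate P e j ≤ (R.state t' k).observation j := by
  refine (NodeState.exists_estimate_le P hH e j).imp id ?_
  rintro ⟨k, hk, hkH, hle⟩
  obtain ⟨t', ht'⟩ := R.reported_of_correct hN hH hHash hkH (h k hk)
  exact ⟨k, t', by rwa [ht'] at hle⟩

theorem estimate_ne_top (hN : 3 * f + 1 ≤ N) (hH : N ≤ H.card + f)
    (hHash : R.NoHashCollision) {t : ℕ} {i : Fin N} {e : ℕ}
    (h : ∀ j ∈ (R.state t i).selected e, (R.state t i).HasRetrieved (e, j)) (j : Fin N) :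
    (R.state t i).estimate P e j ≠ ⊤ := by
  rcases R.exists_estimate_le_observation hN hH hHash h j with h | ⟨k, t', h⟩
  · simp [h]
  · exact ne_top_of_le_ne_top (NodeState.observation_ne_top (R.finite_completed t' k) j) h

theorem exists_completed_of_le_estimate (hN : 3 * f + 1 ≤ N) (hH : N ≤ H.card + f)
    (hHash : R.NoHashCollision) {t : ℕ} {i : Fin N} {e : ℕ}
    (h : ∀ j ∈ (R.state t i).selected e, (R.state t i).HasRetrieved (e, j)) {x : Inst N}
    (hx : 1 ≤ x.1) (hle : (x.1 : ℕ∞) ≤ (R.state t i).estimate P e x.2) :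
    ∃ k t', (R.state t' k).Completed x := by
  rcases R.exists_estimate_le_observation hN hH hHash h x.2 with h | ⟨k, t', h⟩
  · rw [h, nonpos_iff_eq_zero, Nat.cast_eq_zero] at hle
    omega
  · exact ⟨k, t', NodeState.completed_of_le_observation hx (hle.trans h)⟩

/-- Finite bounds for finitely many nodes leave finitely many instances. This is needed because
`deliverLinked` delivers a finite list. -/
theorem finite_le_estimate (hN : 3 * f + 1 ≤ N) (hH : N ≤ H.card + f)
    (hHash : R.NoHashCollision) {t : ℕ} {i : Fin N} {e : ℕ}
    (h : ∀ j ∈ (R.state t i).selected e, (R.state t i).HasRetrieved (e, j)) :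
    {x : Inst N | (x.1 : ℕ∞) ≤ (R.state t i).estimate P e x.2}.Finite := by
  have key (j : Fin N) : ∃ n : ℕ, (R.state t i).estimate P e j = n :=
    (ENat.ne_top_iff_exists.1 (R.estimate_ne_top hN hH hHash h j)).imp fun _ h => h.symm
  choose n hn using key
  refine (Set.finite_iUnion fun j : Fin N =>
    (Set.finite_Iic (n j)).image fun d => ((d, j) : Inst N)).subset fun x hx => ?_
  simp only [Set.mem_ofPred_eq, hn, Nat.cast_le] at hx
  exact Set.mem_iUnion.2 ⟨x.2, x.1, hx, rfl⟩

theorem selected_eq {t t' : ℕ} (htt : t ≤ t') {i : Fin N} {e : ℕ}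
    (hb : ∀ j, (R.state t i).baOut (e, j) ≠ none) :
    (R.state t' i).selected e = (R.state t i).selected e := by
  refine Finset.Subset.antisymm (fun j hj => ?_) ((R.extends_of_le htt i).selected e)
  obtain ⟨b, hb⟩ := Option.ne_none_iff_exists'.1 (hb j)
  simp only [NodeState.selected, Finset.mem_filter, Finset.mem_univ, true_and] at hj ⊢
  rw [(R.extends_of_le htt i).baOut _ _ hb] at hj
  rw [hb, hj]

/-- With all outputs given and all selected blocks retrieved, everything that enters the estimate is
frozen. -/
theorem estimate_eq {t t' : ℕ} (htt : t ≤ t') {i : Fin N} {e : ℕ}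
    (hb : ∀ j, (R.state t i).baOut (e, j) ≠ none)
    (hr : ∀ j ∈ (R.state t i).selected e, (R.state t i).HasRetrieved (e, j)) (j : Fin N) :
    (R.state t' i).estimate P e j = (R.state t i).estimate P e j := by
  have hmap : ((R.state t i).selected e).val.map (fun k => (R.state t' i).reported P (e, k) j) =
      ((R.state t i).selected e).val.map fun k => (R.state t i).reported P (e, k) j := by
    refine Multiset.map_congr rfl fun k hk => ?_
    obtain ⟨v, hv⟩ := Option.ne_none_iff_exists'.1 (hr k hk)
    have hv' := (R.extends_of_le htt i).result _ _ hv
    simp only [NodeState.reported, NodeState.content, hv, hv']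
  simp only [NodeState.estimate]
  rw [R.selected_eq htt hb, hmap]

/-! ### The retrieval phase -/

/-- The blocks selected by BA in epoch `e` have been retrieved by node `i`, and the blocks
selected by inter-node linking have been delivered or are about to be. -/
structure Linked (t : ℕ) (i : Fin N) (e : ℕ) : Prop where
  baOut : ∀ j, (R.state t i).baOut (e, j) ≠ none
  hasRetrieved : ∀ j ∈ (R.state t i).selected e, (R.state t i).HasRetrieved (e, j)
  delivered : ∀ x : Inst N, 1 ≤ x.1 → (x.1 : ℕ∞) ≤ (R.state t i).estimate P e x.2 →
    x ∈ (R.state t i).delivered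

variable {R} in
theorem Linked.mono {t t' : ℕ} {i : Fin N} {e : ℕ} (h : R.Linked t i e) (htt : t ≤ t') :
    R.Linked t' i e where
  baOut j := (R.extends_of_le htt i).baOut_ne (h.baOut j)
  hasRetrieved j hj := by
    rw [R.selected_eq htt h.baOut] at hj
    exact (R.extends_of_le htt i).hasRetrieved (h.hasRetrieved j hj)
  delivered x hx hle := by
    rw [R.estimate_eq htt h.baOut h.hasRetrieved] at hle
    exact (R.extends_of_le htt i).delivered (h.delivered x hx hle)

theorem retrieval_invariant (t : ℕ) (i : Fin N) :
    (∀ e, 1 ≤ e → e ≤ (R.state t i).finished → R.Linked t i e) ∧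
      ∀ L, (R.state t i).linking = some L → R.Linked t i ((R.state t i).finished + 1) := by
  induction t with
  | zero =>
    simp only [state_zero, NodeState.initial]
    exact ⟨fun e h1 h2 => by omega, fun L hL => by cases hL⟩
  | succ t ih =>
    obtain ⟨ih1, ih2⟩ := ih
    have hle := t.le_succ
    rcases R.retrieval_succ t i with ⟨hl, hf, hd⟩ | ⟨hact, hl, he, hr, hf, D, L, hD, hL, hd, hl'⟩ |
      ⟨hact, ⟨L, hL, -⟩, hl', hf, hd⟩
    · rw [hl, hf]
      exact ⟨fun e h1 h2 => (ih1 e h1 h2).mono hle, fun L hL => (ih2 L hL).mono hle⟩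
    · rw [hf]
      refine ⟨fun e h1 h2 => (ih1 e h1 h2).mono hle, fun _ _ => ?_⟩
      have hb := (R.passed_spec (by omega) he).2
      refine ⟨fun j => (R.extends_of_le hle i).baOut_ne (hb j), fun j hj => ?_,
        fun x hx hxe => ?_⟩
      · rw [R.selected_eq hle hb] at hj
        exact (R.extends_of_le hle i).hasRetrieved (hr j hj)
      · rw [R.estimate_eq hle hb hr] at hxe
        rw [hd]
        by_cases hxD : x ∈ D
        · exact .inl hxD
        · right; rw [hL]; exact ⟨hx, hxe, hxD⟩
    · rw [hf, hl']
      refine ⟨fun e h1 h2 => ?_, fun L hL => by cases hL⟩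
      rcases h2.eq_or_lt with rfl | h2
      · exact (ih2 L hL).mono hle
      · exact (ih1 e h1 (Nat.lt_succ_iff.1 h2)).mono hle

/-- Linked instances are marked delivered as soon as they are chosen, before being retrieved. They
remain in the current `linking` set until `deliverLinked`, whose guard demands their retrieval. -/
theorem delivered_spec {t : ℕ} {i : Fin N} {x : Inst N} (h : x ∈ (R.state t i).delivered) :
    (R.state t i).HasRetrieved x ∨ ∃ L, (R.state t i).linking = some L ∧ x ∈ L := by
  induction t with
  | zero => simp [state_zero, NodeState.initial] at h
  | succ t ih =>
    have hext := R.extends_of_le t.le_succ i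
    rcases R.retrieval_succ t i with ⟨hl, hf, hd⟩ | ⟨hact, hl, he, hr, hf, D, L, hD, hL, hd, hl'⟩ |
      ⟨hact, ⟨L, hL, hr⟩, hl', hf, hd⟩ <;> rw [hd] at h
    · rw [hl]
      exact (ih h).imp hext.hasRetrieved id
    · rcases h with h | h
      · rw [hD] at h
        left
        rcases h with h | ⟨h1, h2⟩
        · rcases ih h with h | ⟨L, hL, -⟩
          · exact hext.hasRetrieved h
          · rw [hl] at hL; cases hL
        · have := hext.hasRetrieved (hr _ h2)
          rwa [← h1] at this
      · exact .inr ⟨L, hl', h⟩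
    · left
      rcases ih h with h | ⟨L', hL', hx⟩
      · exact hext.hasRetrieved h
      · rw [hL] at hL'; cases hL'
        exact hext.hasRetrieved (hr x hx)

/-- Both properties hold when `deliverSelected` creates `L`, since the selected blocks are retrieved
at that moment, and neither depends on the time afterwards. -/
theorem linking_spec (hN : 3 * f + 1 ≤ N) (hH : N ≤ H.card + f) (hHash : R.NoHashCollision)
    {t : ℕ} {i : Fin N} {L : Set (Inst N)} (h : (R.state t i).linking = some L) :
    L.Finite ∧ ∀ x ∈ L, ∃ k t', (R.state t' k).Completed x := by
  induction t with
  | zero => simp [state_zero, NodeState.initial] at h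
  | succ t ih =>
    rcases R.retrieval_succ t i with ⟨hl, hf, hd⟩ |
      ⟨hact, hl, he, hr, hf, D, L', hD, hL, hd, hl'⟩ | ⟨hact, ⟨L', hL, hr⟩, hl', hf, hd⟩
    · exact ih (hl ▸ h)
    · rw [hl'] at h; cases h
      rw [hL]
      exact ⟨(R.finite_le_estimate hN hH hHash hr).subset fun x hx => hx.2.1,
        fun x hx => R.exists_completed_of_le_estimate hN hH hHash hr hx.1 hx.2.1⟩
    · rw [hl'] at h; cases h

/-- A node stays in the linking phase until it has finished the epoch. -/
theorem linking_or_finished {t t' : ℕ} (htt : t ≤ t') {i : Fin N} {L : Set (Inst N)}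
    (h : (R.state t i).linking = some L) :
    ((R.state t' i).linking = some L ∧ (R.state t' i).finished = (R.state t i).finished) ∨
      (R.state t i).finished < (R.state t' i).finished ∧
        ∀ x ∈ L, (R.state t' i).HasRetrieved x := by
  induction htt with
  | refl => exact .inl ⟨h, rfl⟩
  | step htt ih =>
    rename_i t'
    have hext := R.extends_of_le t'.le_succ i
    rcases ih with ⟨ih, ihf⟩ | ⟨ihf, ih⟩
    · rcases R.retrieval_succ t' i with ⟨hl, hf, hd⟩ | ⟨hact, hl, -⟩ |
        ⟨hact, ⟨L', hL, hr⟩, hl', hf, hd⟩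
      · exact .inl ⟨hl.trans ih, hf.trans ihf⟩
      · rw [hl] at ih; cases ih
      · rw [hL] at ih; cases ih
        exact .inr ⟨by rw [Nat.succ_eq_add_one, hf]; omega,
          fun x hx => hext.hasRetrieved (hr x hx)⟩
    · exact .inr ⟨ihf.trans_le hext.finished, fun x hx => hext.hasRetrieved (ih x hx)⟩

/-- A node can stay in its retrieval phase between epochs only until it starts the next one. -/
theorem not_linking_or {t t' : ℕ} (htt : t ≤ t') {i : Fin N} (h : (R.state t i).linking = none) :
    ((R.state t' i).linking = none ∧ (R.state t' i).finished = (R.state t i).finished) ∨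
      ∃ t'' ≥ t, (R.state t'' i).finished = (R.state t i).finished ∧
        (R.state t'' i).linking ≠ none := by
  induction htt with
  | refl => exact .inl ⟨h, rfl⟩
  | step htt ih =>
    rename_i t'
    rcases ih with ⟨ih, ihf⟩ | ih
    · rcases R.retrieval_succ t' i with ⟨hl, hf, hd⟩ | ⟨hact, hl, -, -, hf, D, L, -, -, -, hl'⟩ |
        ⟨hact, ⟨L', hL, hr⟩, hl', hf, hd⟩
      · exact .inl ⟨hl.trans ih, hf.trans ihf⟩
      · exact .inr ⟨t' + 1, Nat.le_succ_of_le htt, hf.trans ihf, by rw [hl']; simp⟩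
      · rw [hL] at ih; cases ih
    · exact .inr ih

theorem invoked_of_retrieve {t : ℕ} {i : Fin N} {x : Inst N} (h : R.act t = .retrieve i x) :
    ((R.state (t + 1) i).client x).invoked := by
  have hs := R.step t
  rw [h] at hs
  obtain ⟨-, -, -, hs⟩ := hs
  simp only [state]
  rw [hs]
  simp [Config.update]

/-! ### Progress of the retrieval phase -/

theorem eventually_hasRetrieved_selected (hBA : ∀ x, R.IsBinaryAgreement x)
    (hN : 3 * f + 1 ≤ N) (hH : N ≤ H.card + f) {i : Fin N} (hi : i ∈ H) {t : ℕ} {e : ℕ}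
    {j : Fin N} (hj : j ∈ (R.state t i).selected e) :
    ∃ t', (R.state t' i).HasRetrieved (e, j) := by
  obtain ⟨t₁, ht₁⟩ := R.eventually_epoch hBA hN hH (e := e + 1) i hi
  obtain ⟨k, hk, hin⟩ := (hBA (e, j)).validity true i hi t (by
    simpa [NodeState.selected] using hj)
  obtain ⟨t₂, -, ht₂⟩ := R.eventually_of_fair (a := .retrieve i (e, j)) trivial (max t t₁)
    (p := fun t => ((R.state t i).client (e, j)).invoked)
    (fun t' ht' hn => by
      have h1 := R.extends_of_le ((le_max_left _ _).trans ht') i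
      have h2 := R.extends_of_le ((le_max_right _ _).trans ht') i
      exact ⟨_, hi, hn, .inl ⟨ht₁.trans h2.epoch, h1.selected e hj⟩, rfl⟩)
    (fun t' ht' hact => R.invoked_of_retrieve hact)
  exact R.eventually_hasRetrieved hN hH ((R.baIn_spec hin).1 rfl) hi ht₂

theorem eventually_hasRetrieved_linked (hN : 3 * f + 1 ≤ N) (hH : N ≤ H.card + f)
    (hHash : R.NoHashCollision) {i : Fin N} (hi : i ∈ H) {t : ℕ} {L : Set (Inst N)}
    (hL : (R.state t i).linking = some L) {x : Inst N} (hx : x ∈ L) :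
    ∃ t', (R.state t' i).HasRetrieved x := by
  obtain ⟨k, t₀, hc⟩ := (R.linking_spec hN hH hHash hL).2 x hx
  obtain ⟨t₁, -, ht₁⟩ := R.eventually_of_fair (a := .retrieve i x) trivial t
    -- The second alternative covers a node that has finished the epoch: `retrieve` is then no
    -- longer enabled through `L`, but all of `L` has been retrieved.
    (p := fun t => ((R.state t i).client x).invoked ∨ (R.state t i).HasRetrieved x)
    (fun t' ht' hn => by
      push Not at hn
      rcases R.linking_or_finished ht' hL with h | h
      · exact ⟨_, hi, hn.1, .inr ⟨L, h.1, hx⟩, rfl⟩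
      · exact absurd (h.2 x hx) hn.2)
    (fun t' ht' hact => .inl (R.invoked_of_retrieve hact))
  rcases ht₁ with h | h
  · exact R.eventually_hasRetrieved hN hH hc hi h
  · exact ⟨t₁, h⟩

theorem eventually_hasRetrieved_of_delivered (hN : 3 * f + 1 ≤ N) (hH : N ≤ H.card + f)
    (hHash : R.NoHashCollision) {i : Fin N} (hi : i ∈ H) {t : ℕ} {x : Inst N}
    (hx : x ∈ (R.state t i).delivered) : ∃ t', (R.state t' i).HasRetrieved x := by
  rcases R.delivered_spec hx with h | ⟨L, hL, hx⟩
  · exact ⟨t, h⟩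
  · exact R.eventually_hasRetrieved_linked hN hH hHash hi hL hx

theorem eventually_finished_of_linking (hN : 3 * f + 1 ≤ N) (hH : N ≤ H.card + f)
    (hHash : R.NoHashCollision) {i : Fin N} (hi : i ∈ H) {t : ℕ}
    (h : (R.state t i).linking ≠ none) :
    ∃ t', (R.state t i).finished < (R.state t' i).finished := by
  obtain ⟨L, hL⟩ := Option.ne_none_iff_exists'.1 h
  have hfin := (R.linking_spec hN hH hHash hL).1
  obtain ⟨T, hT⟩ := exists_forall_mem_of_monotone hfin
    (p := fun x t => (R.state t i).HasRetrieved x)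
    (fun x _ t t' htt h => (R.extends_of_le htt i).hasRetrieved h)
    (fun x hx => R.eventually_hasRetrieved_linked hN hH hHash hi hL hx)
  obtain ⟨l, hl, hsort⟩ := exists_sorted_list hfin
  obtain ⟨t', -, ht'⟩ := R.eventually_of_fair (a := .deliverLinked i) trivial (max t T)
    (p := fun t' => (R.state t i).finished < (R.state t' i).finished)
    (fun t' ht' hn => by
      rcases R.linking_or_finished ((le_max_left _ _).trans ht') hL with h | h
      · exact ⟨_, hi, L, l, h.1, fun x hx =>
          (R.extends_of_le ((le_max_right _ _).trans ht') i).hasRetrieved (hT x hx),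
          hl, hsort, rfl⟩
      · exact absurd h.1 hn)
    (fun t' ht' hact => by
      have hmono := (R.extends_of_le ((le_max_left _ _).trans ht') i).finished
      have hs := R.step t'
      rw [hact] at hs
      obtain ⟨-, _, _, -, -, -, -, hs⟩ := hs
      simp only [state] at hmono ⊢
      rw [hs]
      simpa [Config.setNode] using Nat.lt_succ_of_le hmono)
  exact ⟨t', ht'⟩

theorem eventually_finished_succ (hBA : ∀ x, R.IsBinaryAgreement x) (hN : 3 * f + 1 ≤ N)
    (hH : N ≤ H.card + f) (hHash : R.NoHashCollision) {i : Fin N} (hi : i ∈ H) (t : ℕ) :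
    ∃ t', (R.state t i).finished < (R.state t' i).finished := by
  by_cases hlink : (R.state t i).linking = none
  swap
  · exact R.eventually_finished_of_linking hN hH hHash hi hlink
  suffices ∃ t' ≥ t, (R.state t' i).finished = (R.state t i).finished ∧
      (R.state t' i).linking ≠ none by
    obtain ⟨t', -, hf, hl⟩ := this
    rw [← hf]
    exact R.eventually_finished_of_linking hN hH hHash hi hl
  -- Without progress, `linking` stays `none` and `finished` stays constant. Then `deliverSelected`
  -- is enabled from some time on, and executing it sets `linking`.
  by_contra hno
  have hstay (t') (ht' : t ≤ t') := (R.not_linking_or ht' hlink).resolve_right hno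
  set e := (R.state t i).finished + 1 with he
  obtain ⟨t₁, ht₁⟩ := R.eventually_epoch hBA hN hH (e := e + 1) i hi
  have hb := (R.passed_spec (e := e) (by omega) ht₁).2
  obtain ⟨T, hT⟩ := exists_forall_mem_of_monotone
    (s := ((R.state t₁ i).selected e : Set (Fin N))) (Finset.finite_toSet _)
    (p := fun j t => (R.state t i).HasRetrieved (e, j))
    (fun x _ t t' htt h => (R.extends_of_le htt i).hasRetrieved h)
    (fun j hj => R.eventually_hasRetrieved_selected hBA hN hH hi hj)
  obtain ⟨t', ht', hact⟩ := R.fair (.deliverSelected i) trivial (t + t₁ + T) (fun t' ht' => by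
    obtain ⟨hl, hf⟩ := hstay t' (by omega)
    have h1 := R.extends_of_le (show t₁ ≤ t' by omega) i
    have hf' : (R.state t' i).finished + 1 = e := by omega
    refine ⟨_, hi, hl, ?_, ?_, rfl⟩
    · exact hf'.trans_lt (ht₁.trans h1.epoch)
    · intro j hj
      change j ∈ (R.state t' i).selected ((R.state t' i).finished + 1) at hj
      change (R.state t' i).HasRetrieved ((R.state t' i).finished + 1, j)
      rw [hf'] at hj ⊢
      rw [R.selected_eq (by omega) hb] at hj
      exact (R.extends_of_le (show T ≤ t' by omega) i).hasRetrieved (hT j hj))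
  obtain ⟨hl, hf⟩ := hstay (t' + 1) (by omega)
  have hs := R.step t'
  rw [hact] at hs
  obtain ⟨-, -, -, -, hs⟩ := hs
  simp only [state] at hl
  rw [hs] at hl
  simp [Config.setNode] at hl

theorem eventually_finished (hBA : ∀ x, R.IsBinaryAgreement x) (hN : 3 * f + 1 ≤ N)
    (hH : N ≤ H.card + f) (hHash : R.NoHashCollision) {i : Fin N} (hi : i ∈ H) (e : ℕ) :
    ∃ t, e ≤ (R.state t i).finished := by
  induction e with
  | zero => exact ⟨0, Nat.zero_le _⟩
  | succ e ih =>
    obtain ⟨t, ht⟩ := ih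
    obtain ⟨t', ht'⟩ := R.eventually_finished_succ hBA hN hH hHash hi t
    exact ⟨t', by omega⟩

end Execution

end

end DispersedLedger

/-! ### The main theorem -/

theorem mainTheorem3 {N f : ℕ} {Tx Data Chunk Digest : Type*}
    (P : DispersedLedger.Params N f Tx Data Chunk Digest)
    (hN : 3 * f + 1 ≤ N)
    (H : Finset (Fin N)) (hH : N ≤ H.card + f)
    (R : DispersedLedger.Execution P H)
    (hBA : ∀ x, R.IsBinaryAgreement x)
    (hHash : R.NoHashCollision)
    (e : ℕ) (he : 1 ≤ e) (i : Fin N) (hi : i ∈ H) :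
    -- at least `N - f` BA instances of epoch `e` output `1`
    (∃ t, N - f ≤ ((R.state t i).selected e).card) ∧
    -- all BA instances of epoch `e` terminate
    (∃ t, ∀ j, (R.state t i).baOut (e, j) ≠ none) ∧
    -- the retrievals of the blocks selected by BA complete
    (∀ t, ∀ j ∈ (R.state t i).selected e, ∃ t', (R.state t' i).HasRetrieved (e, j)) ∧
    -- the retrievals of the blocks selected by inter-node linking complete
    (∀ t, (∀ j, (R.state t i).baOut (e, j) ≠ none) →
      (∀ j ∈ (R.state t i).selected e, (R.state t i).HasRetrieved (e, j)) →
      ∀ (j : Fin N) (d : ℕ), 1 ≤ d → (d : ℕ∞) ≤ (R.state t i).estimate P e j →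
        ∃ t', (R.state t' i).HasRetrieved (d, j)) ∧
    -- node `i` finishes epoch `e`
    (∃ t, e ≤ (R.state t i).finished) := by
  have hreach := R.eventually_epoch hBA hN hH (e := e)
  refine ⟨R.eventually_card_selected hBA hN hH he hreach hi,
    R.eventually_baOut hBA hN hH he hreach hi,
    fun t j hj => R.eventually_hasRetrieved_selected hBA hN hH hi hj,
    fun t hb hr j d hd hle => ?_, R.eventually_finished hBA hN hH hHash hi e⟩
  -- An instance below the estimate may have been delivered in an earlier epoch and be absent from
  -- `L`. The argument therefore goes through `delivered` once epoch `e` is finished, with the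
  -- estimate carried over to the later time.
  obtain ⟨t₁, ht₁⟩ := R.eventually_finished hBA hN hH hHash hi e
  have hlinked := ((R.retrieval_invariant t₁ i).1 e he ht₁).mono (le_max_right t t₁)
  refine R.eventually_hasRetrieved_of_delivered hN hH hHash hi (hlinked.delivered (d, j) hd ?_)
  rwa [R.estimate_eq (le_max_left t t₁) hb hr]
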